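/- **Setting.** All languages are first-order and many-sorted. Let $I$ be a non-empty index set and let $L_\cap$ and $(L_i)_{i\in I}$ be languages with the same set of sorts such that $L_\cap\subseteq L_i$ for all $i$ and $L_i\cap L_j=L_\cap$ for $i\neq j$. Let $T_i$ be a (possibly incomplete) $L_i$-theory for each $i$, and assume that all $T_i$ have the same set $T_\cap$ of $L_\cap$-consequences. Put $L_\cup=\bigcup_i L_i$, $T_\cup=\bigcup_i T_i$, and assume that $T_\cup$ is consistent. For an $L_\cup$-structure $\mathscr M_\cup$ let $\mathscr M_i$, $\mathscr M_\cap$ be its reducts to $L_i$, $L_\cap$, and let $\mathrm{acl}_i$, $\mathrm{acl}_\cap$ denote algebraic closure in these reducts. "Definable" means definable with parameters. A model $\mathscr M_\cup\models T_\cup$ is *interpolative* if whenever $J\subseteq I$ is finite and $X_i$ $(i\in J)$ are $\mathscr M_i$-definable sets with $\bigcap_{i\in J}X_i=\emptyset$, there are $\mathscr M_\cap$-definable sets $Y_i\supseteq X_i$ $(i\in J)$ with $\bigcap_{i\in J}Y_i=\emptyset$. Assume that the interpolative models of $T_\cup$ form an elementary class, and let $T^*_\cup$ be their theory. Let $\boldsymbol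 M$ be a monster model of a complete theory $T$. A ternary relation $A\perp_C B$ on small subsets of $\boldsymbol M$ is a *stationary independence relation* in $T$ if (1) it is invariant under automorphisms of $\boldsymbol M$; (2) $A\perp_C B$ implies $\mathrm{acl}(AC)\cap\mathrm{acl}(BC)=\mathrm{acl}(C)$; (3) if $C=\mathrm{acl}(C)$, $\mathrm{tp}(A/C)=\mathrm{tp}(A^*/C)$, $A\perp_C B$ and $A^*\perp_C B$, then $\mathrm{tp}(A/BC)=\mathrm{tp}(A^*/BC)$ (types are those of enumerations by tuples). If $\boldsymbol M$ is the $L$-reduct of a monster model $\boldsymbol M'$ of a complete $L'$-theory $T'\supseteq T$, with $L'\supseteq L$ having the same sorts, the relation is *extendable* to $T'$ if for all small $A,B,C$ with $C=\mathrm{acl}_{L'}(C)$ there is $A^*$ with $\mathrm{tp}_{L'}(A^*/C)=\mathrm{tp}_{L'}(A/C)$ and $A^*\perp_C B$. We say that $T_\cap$ *admits a stationary and extendable independence relation* if whenever $\widehat T_\cap$ is a completion of $T_\cap$ and, for each $i$, $\widehat T_i\supseteq\widehat T_\cap$ is a completion of $T_i$, there is a stationary independence relation in $\widehat T_\cap$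 which is extendable to every $\widehat T_i$. For $A\subseteq B\subseteq M$, let $\mathrm{Aut}_{L}(B/A)$ be the group of bijections $B\to B$ that are partial elementary in the sense of $L$ and fix $A$ pointwise. A theory is *stable* (resp. *NIP*) if in no model of it does a formula $\varphi(x;y)$ ($x,y$ finite tuples of variables) have the order property (resp. the independence property). It is *stable in $\kappa$* if for every model $\mathscr M$ of it, every $A\subseteq M$ with $|A|\le\kappa$ and every finite tuple $x$ of variables, there are at most $\kappa$ complete types in $x$ over $A$. **Proposition.** Assume that $T_\cap$ admits a stationary and extendable independence relation, and that $$\mathrm{acl}_i(A)=\mathrm{acl}_\cap(A)\quad\text{and}\quad \mathrm{Aut}_{L_\cap}(\mathrm{acl}_\cap(A)/A)=\mathrm{Aut}_{L_i}(\mathrm{acl}_\cap(A)/A)$$ for all subsets $A$ of models of $T^*_\cup$ and all $i\in I$. Then: 1. Every $L_\cup$-formula $\psi(x)$ is $T^*_\cup$-equivalent to a Boolean combination of formulas $\varphi(x)$, each of which is an $L_i$-formula for some $i\in I$. 2. If each $T_i$ is stable, then $T^*_\cup$ is stable. 3. If each $T_i$ is NIP, then $T^*_\cup$ is NIP. 4.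 If $\kappa$ is an infinite cardinal with $\kappa^{|I|}=\kappa$ and each $T_i$ is stable in $\kappa$, then $T^*_\cup$ is stable in $\kappa$. -/

import Mathlib

universe u v w w'

namespace ManySorted

/-- A many-sorted first-order language with set of sorts `S`: `Func d s` is the type of function
symbols of type `d → s`, and `Rel d` is the type of relation symbols of type `d`. -/
structure Language (S : Type u) where
  Func : List S → S → Type u
  Rel : List S → Type u

/-- A map of languages over the same sorts. -/
structure LHom {S : Type u} (L L' : Language.{u} S) where
  onFunc : ∀ {d : List S} {s : S}, L.Func d s → L'.Func d s
  onRel : ∀ {d : List S}, L.Rel d → L'.Rel d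

/-- A sublanguage of `L`: a set of symbols of `L`, with the same sorts. -/
@[ext]
structure Sublanguage {S : Type u} (L : Language.{u} S) where
  funcs : ∀ (d : List S) (s : S), Set (L.Func d s)
  rels : ∀ d : List S, Set (L.Rel d)

section Logic

variable {S : Type u}

namespace Sublanguage

variable {L : Language.{u} S}

/-- A sublanguage, as a language. -/
def lang (K : Sublanguage L) : Language.{u} S where
  Func d s := K.funcs d s
  Rel d := K.rels d

/-- Inclusion of sublanguages. -/
def Subset (K K' : Sublanguage L) : Prop :=
  (∀ d s, K.funcs d s ⊆ K'.funcs d s) ∧ (∀ d, K.rels d ⊆ K'.rels d)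

/-- Intersection of two sublanguages. -/
def inter (K K' : Sublanguage L) : Sublanguage L where
  funcs d s := K.funcs d s ∩ K'.funcs d s
  rels d := K.rels d ∩ K'.rels d

/-- The inclusion of a sublanguage in the whole language. -/
def incl (K : Sublanguage L) : LHom K.lang L where
  onFunc f := f.1
  onRel r := r.1

/-- The inclusion of a sublanguage in a larger one. -/
def inclOf {K K' : Sublanguage L} (h : Subset K K') : LHom K.lang K'.lang where
  onFunc {d s} f := ⟨f.1, h.1 d s f.2⟩
  onRel {d} r := ⟨r.1, h.2 d r.2⟩

end Sublanguage

/-- Terms in the variables `x ∈ V`, where `x` has sort `σ x`, indexed by the sort of the term. -/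
inductive Term (L : Language.{u} S) {V : Type v} (σ : V → S) : S → Type (max u v)
  | var (x : V) : Term L σ (σ x)
  | func {d : List S} {s : S} (f : L.Func d s)
      (ts : ∀ k : Fin d.length, Term L σ (d.get k)) : Term L σ s

/-- Formulas whose free variables are the `x ∈ V` (of sort `σ x`) together with a list of
variables, the most recently quantified first, whose sorts are listed in `Γ`. -/
inductive BForm (L : Language.{u} S) {V : Type v} (σ : V → S) : List S → Type (max u v)
  | falsum {Γ : List S} : BForm L σ Γ
  | equal {Γ : List S} {s : S}
      (t t' : Term L (Sum.elim σ (fun k : Fin Γ.length => Γ.get k)) s) : BForm L σ Γ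
  | rel {Γ d : List S} (R : L.Rel d)
      (ts : ∀ k : Fin d.length,
        Term L (Sum.elim σ (fun k : Fin Γ.length => Γ.get k)) (d.get k)) : BForm L σ Γ
  | imp {Γ : List S} (φ ψ : BForm L σ Γ) : BForm L σ Γ
  | all {Γ : List S} (s : S) (φ : BForm L σ (s :: Γ)) : BForm L σ Γ

/-- `L`-formulas in the variables `x ∈ V`, where `x` has sort `σ x`. -/
abbrev Formula (L : Language.{u} S) {V : Type v} (σ : V → S) : Type (max u v) := BForm L σ []

/-- Negation. -/
abbrev BForm.neg {L : Language.{u} S} {V : Type v} {σ : V → S} {Γ : List S} (φ : BForm L σ Γ) :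
    BForm L σ Γ := φ.imp .falsum

/-- Sentences are formulas without free variables. -/
abbrev Sentence (L : Language.{u} S) : Type u := Formula L (V := Empty) Empty.elim

/-- A theory is a set of sentences. -/
abbrev Theory (L : Language.{u} S) : Type u := Set (Sentence L)

/-- The translation of terms along a map of languages. -/
def Term.map {L L' : Language.{u} S} (h : LHom L L') {V : Type v} {σ : V → S} :
    ∀ {s : S}, Term L σ s → Term L' σ s
  | _, .var x => .var x
  | _, .func f ts => .func (h.onFunc f) (fun k => (ts k).map h)

/-- The translation of formulas along a map of languages. -/
def BForm.map {L L' : Language.{u} S} (h : LHom L L') {V : Type v} {σ : V → S} :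
    ∀ {Γ : List S}, BForm L σ Γ → BForm L' σ Γ
  | _, .falsum => .falsum
  | _, .equal t t' => .equal (t.map h) (t'.map h)
  | _, .rel R ts => .rel (h.onRel R) (fun k => (ts k).map h)
  | _, .imp φ ψ => .imp (φ.map h) (ψ.map h)
  | _, .all s φ => .all s (φ.map h)

/-- An `L`-structure with underlying sets `M s`, one for each sort `s` (possibly empty). -/
@[ext]
structure Interp (L : Language.{u} S) (M : S → Type w) where
  funMap : ∀ {d : List S} {s : S}, L.Func d s → (∀ k : Fin d.length, M (d.get k)) → M s
  relMap : ∀ {d : List S}, L.Rel d → (∀ k : Fin d.length, M (d.get k)) → Prop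

/-- The reduct of a structure along a map of languages. -/
def Interp.reduct {L L' : Language.{u} S} {M : S → Type w} (I : Interp L' M) (h : LHom L L') :
    Interp L M where
  funMap f := I.funMap (h.onFunc f)
  relMap R := I.relMap (h.onRel R)

/-- The value of a term. -/
def Term.eval {L : Language.{u} S} {M : S → Type w} (I : Interp L M) {V : Type v} {σ : V → S}
    (a : ∀ x, M (σ x)) : ∀ {s : S}, Term L σ s → M s
  | _, .var x => a x
  | _, .func f ts => I.funMap f (fun k => (ts k).eval I a)

/-- The concatenation of two tuples. -/
def tupleSum {M : S → Type w} {V : Type v} {V' : Type w'} {σ : V → S} {τ : V' → S}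
    (a : ∀ x, M (σ x)) (b : ∀ y, M (τ y)) : ∀ z : V ⊕ V', M (Sum.elim σ τ z)
  | .inl x => a x
  | .inr y => b y

/-- Satisfaction, given values of the free variables in `V` and of those listed in `Γ`. -/
def BForm.Sat {L : Language.{u} S} {M : S → Type w} (I : Interp L M) {V : Type v} {σ : V → S}
    (a : ∀ x, M (σ x)) : ∀ {Γ : List S}, BForm L σ Γ → (∀ k : Fin Γ.length, M (Γ.get k)) → Prop
  | _, .falsum, _ => False
  | _, .equal t t', e => t.eval I (tupleSum a e) = t'.eval I (tupleSum a e)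
  | _, .rel R ts, e => I.relMap R (fun k => (ts k).eval I (tupleSum a e))
  | _, .imp φ ψ, e => φ.Sat I a e → ψ.Sat I a e
  | Γ, .all s φ, e => ∀ m : M s,
      φ.Sat I a (Fin.cons (n := Γ.length) (α := fun k => M ((s :: Γ).get k)) m e)

/-- `I ⊨ φ(a)`. -/
def Interp.Realize {L : Language.{u} S} {M : S → Type w} (I : Interp L M) {V : Type v}
    {σ : V → S} (φ : Formula L σ) (a : ∀ x, M (σ x)) : Prop :=
  φ.Sat I a (fun k => k.elim0)

/-- Truth of a sentence in a structure. -/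
def Interp.Holds {L : Language.{u} S} {M : S → Type w} (I : Interp L M) (φ : Sentence L) : Prop :=
  I.Realize φ (fun x => x.elim)

/-- `I` is a model of `T`. -/
def Interp.Models {L : Language.{u} S} {M : S → Type w} (I : Interp L M) (T : Theory L) : Prop :=
  ∀ φ ∈ T, I.Holds φ

/-- `T` has a model. -/
def Theory.Consistent {L : Language.{u} S} (T : Theory L) : Prop :=
  ∃ (M : S → Type u) (I : Interp L M), I.Models T

/-- `φ` is a consequence of `T`. -/
def Theory.Entails {L : Language.{u} S} (T : Theory L) (φ : Sentence L) : Prop :=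
  ∀ (M : S → Type u) (I : Interp L M), I.Models T → I.Holds φ

/-- `T'` is a completion of `T`. -/
def Theory.IsCompletion {L : Language.{u} S} (T T' : Theory L) : Prop :=
  T ⊆ T' ∧ Theory.Consistent T' ∧ ∀ φ : Sentence L, φ ∈ T' ∨ φ.neg ∈ T'

/-! ### Subsets, parameters, types -/

/-- A subset of `M`: a subset of `M s` for each sort `s`. -/
abbrev Sub (M : S → Type w) : Type (max u w) := ∀ s, Set (M s)

/-- `L(A)`-formulas in the variables `x`. An element of `A` is used as a variable which is
always interpreted as that element. -/
abbrev PFormula (L : Language.{u} S) {M : S → Type w} {J : Type v} (x : J → S) (A : Sub M) :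
    Type (max u v w) :=
  Formula L (Sum.elim x (fun c : (Σ s, A s) => c.1))

/-- `I ⊨ φ(a)` for an `L(A)`-formula `φ(x)`. -/
def Interp.PRealize {L : Language.{u} S} {M : S → Type w} (I : Interp L M) {J : Type v}
    {x : J → S} {A : Sub M} (φ : PFormula L x A) (a : ∀ j, M (x j)) : Prop :=
  I.Realize φ (tupleSum a (fun c : (Σ s, A s) => (c.2 : M c.1)))

/-- The set of components of a tuple. -/
def tupleSet {M : S → Type w} {J : Type v} {x : J → S} (a : ∀ j, M (x j)) : Sub M :=
  fun s => {m | ∃ j, (⟨x j, a j⟩ : Σ s, M s) = ⟨s, m⟩}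

/-- `tp_L(a) = tp_L(b)`, for possibly infinite tuples, possibly in different structures. -/
def SameType {L : Language.{u} S} {M : S → Type w} {N : S → Type w'} (I : Interp L M)
    (I' : Interp L N) {J : Type v} {x : J → S} (a : ∀ j, M (x j)) (b : ∀ j, N (x j)) : Prop :=
  ∀ φ : Formula L x, I.Realize φ a ↔ I'.Realize φ b

/-- `tp_L(a/C) = tp_L(b/C)`. -/
def SameTypeOver {L : Language.{u} S} {M : S → Type w} (I : Interp L M) (C : Sub M)
    {J : Type v} {x : J → S} (a b : ∀ j, M (x j)) : Prop :=
  ∀ φ : PFormula L x C, I.PRealize φ a ↔ I.PRealize φ b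

/-- `X ⊆ M^x` is definable with parameters. -/
def Definable {L : Language.{u} S} {M : S → Type w} (I : Interp L M) {J : Type v} {x : J → S}
    (X : Set (∀ j, M (x j))) : Prop :=
  ∃ φ : PFormula L x (fun s => (Set.univ : Set (M s))), X = {a | I.PRealize φ a}

/-- Algebraic closure. -/
def acl {L : Language.{u} S} {M : S → Type w} (I : Interp L M) (A : Sub M) : Sub M :=
  fun s => {b | ∃ φ : PFormula L (fun _ : Unit => s) A,
    I.PRealize φ (fun _ => b) ∧ {b' : M s | I.PRealize φ (fun _ => b')}.Finite}

/-- `Aut_L(B/A)`: the partial elementary bijections `B → B` which fix `A` pointwise. -/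
def autOver {L : Language.{u} S} {M : S → Type w} (I : Interp L M) (B A : Sub M) :
    Set (∀ s, Equiv.Perm (B s)) :=
  {f | SameType I I (x := fun c : (Σ s, B s) => c.1) (fun c => (c.2 : M c.1))
      (fun c => (f c.1 c.2 : M c.1)) ∧
    ∀ (s : S) (b : B s), (b : M s) ∈ A s → f s b = b}

/-- An automorphism of a structure. -/
structure Automorphism {L : Language.{u} S} {M : S → Type w} (I : Interp L M) where
  toPerm : ∀ s, Equiv.Perm (M s)
  map_fun : ∀ {d : List S} {s : S} (f : L.Func d s) (a : ∀ k : Fin d.length, M (d.get k)),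
    toPerm s (I.funMap f a) = I.funMap f (fun k => toPerm _ (a k))
  map_rel : ∀ {d : List S} (R : L.Rel d) (a : ∀ k : Fin d.length, M (d.get k)),
    I.relMap R (fun k => toPerm _ (a k)) ↔ I.relMap R a

/-- The image of a set under an automorphism. -/
def Automorphism.image {L : Language.{u} S} {M : S → Type w} {I : Interp L M}
    (g : Automorphism I) (A : Sub M) : Sub M :=
  fun s => g.toPerm s '' A s

/-! ### Monster models and independence relations -/

/-- A subset of a monster model is small if it is in bijection with a type in the universe `u`,
in which sorts, languages and ordinary models live. The monster itself lives one universe up. -/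
def SmallSub {M : S → Type (u + 1)} (A : Sub M) : Prop :=
  Small.{u} (Σ s, A s)

/-- Monster models: types over small sets are realized, and partial elementary maps between
small sets extend to automorphisms. -/
structure IsMonster {L : Language.{u} S} {M : S → Type (u + 1)} (I : Interp L M) : Prop where
  saturated : ∀ C : Sub M, SmallSub C → ∀ (J : Type u) (x : J → S) (p : Set (PFormula L x C)),
    (∀ F : Finset (PFormula L x C), (F : Set (PFormula L x C)) ⊆ p →
      ∃ a : ∀ j, M (x j), ∀ φ ∈ F, I.PRealize φ a) →
    ∃ a : ∀ j, M (x j), ∀ φ ∈ p, I.PRealize φ a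
  homogeneous : ∀ (J : Type u) (x : J → S) (a b : ∀ j, M (x j)), SameType I I a b →
    ∃ g : Automorphism I, ∀ j, g.toPerm (x j) (a j) = b j

/-- A stationary independence relation on the small subsets of the monster model `I`.
`ind A B C` stands for "`A` is independent from `B` over `C`". -/
structure StationaryIndep {L : Language.{u} S} {M : S → Type (u + 1)} (I : Interp L M)
    (ind : Sub M → Sub M → Sub M → Prop) : Prop where
  invariance : ∀ A B C : Sub M, SmallSub A → SmallSub B → SmallSub C → ∀ g : Automorphism I,
    ind A B C ↔ ind (g.image A) (g.image B) (g.image C)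
  algebraic : ∀ A B C : Sub M, SmallSub A → SmallSub B → SmallSub C → ind A B C →
    acl I (A ⊔ C) ⊓ acl I (B ⊔ C) = acl I C
  stationarity : ∀ (J : Type u) (x : J → S) (a a' : ∀ j, M (x j)) (B C : Sub M),
    SmallSub B → SmallSub C → acl I C = C → SameTypeOver I C a a' →
    ind (tupleSet a) B C → ind (tupleSet a') B C → SameTypeOver I (B ⊔ C) a a'

/-- Full existence over algebraically closed sets in the expansion `I'` of the monster model
on which the relation `ind` is given. -/
def Extendable {L' : Language.{u} S} {M : S → Type (u + 1)} (I' : Interp L' M)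
    (ind : Sub M → Sub M → Sub M → Prop) : Prop :=
  ∀ (J : Type u) (x : J → S) (a : ∀ j, M (x j)) (B C : Sub M),
    SmallSub B → SmallSub C → acl I' C = C →
    ∃ a' : ∀ j, M (x j), SameTypeOver I' C a' a ∧ ind (tupleSet a') B C

/-! ### Stability and NIP -/

/-- No formula has the order property in a model of `T`. -/
def Theory.Stable {L : Language.{u} S} (T : Theory L) : Prop :=
  ∀ (M : S → Type u) (I : Interp L M), I.Models T →
  ∀ (m n : ℕ) (x : Fin m → S) (y : Fin n → S) (φ : Formula L (Sum.elim x y)),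
    ¬ ∃ (a : ℕ → ∀ j, M (x j)) (b : ℕ → ∀ j, M (y j)),
      ∀ k l : ℕ, I.Realize φ (tupleSum (a k) (b l)) ↔ k < l

/-- No formula has the independence property in a model of `T`. -/
def Theory.NIP {L : Language.{u} S} (T : Theory L) : Prop :=
  ∀ (M : S → Type u) (I : Interp L M), I.Models T →
  ∀ (m n : ℕ) (x : Fin m → S) (y : Fin n → S) (φ : Formula L (Sum.elim x y)),
    ¬ ∃ (a : ℕ → ∀ j, M (x j)) (b : Set ℕ → ∀ j, M (y j)),
      ∀ (k : ℕ) (X : Set ℕ), I.Realize φ (tupleSum (a k) (b X)) ↔ k ∈ X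

/-- `S^x_L(A)`: the complete `L`-types over `A` in the variables `x`, i.e. the complete sets of
`L(A)`-formulas which are finitely satisfiable in the given structure. -/
def TypeSpace {L : Language.{u} S} {M : S → Type w} (I : Interp L M) (A : Sub M)
    {J : Type v} (x : J → S) : Set (Set (PFormula L x A)) :=
  {p | (∀ φ : PFormula L x A, φ ∈ p ∨ φ.neg ∈ p) ∧
    ∀ F : Finset (PFormula L x A), (F : Set (PFormula L x A)) ⊆ p →
      ∃ a : ∀ j, M (x j), ∀ φ ∈ F, I.PRealize φ a}

/-- `T` is stable in `κ`: there are at most `κ` types in finitely many variables over any set of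
at most `κ` parameters in a model of `T`. -/
def Theory.StableIn {L : Language.{u} S} (T : Theory L) (κ : Cardinal.{u}) : Prop :=
  ∀ (M : S → Type u) (I : Interp L M), I.Models T →
  ∀ A : Sub M, Cardinal.mk (Σ s, A s) ≤ κ →
  ∀ (n : ℕ) (x : Fin n → S), Cardinal.mk (TypeSpace I A x) ≤ κ

end Logic

/-! ### Interpolative fusions -/

/-- A family of languages `lang i` with the same sorts, such that `lang i ∩ lang j = cap` for
`i ≠ j`, and of theories `T i` with the same set `Tcap` of `cap`-consequences. The language `L`
is the union of the `lang i`, and the union of the theories is consistent. -/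
structure FusionFamily (S I : Type u) where
  L : Language.{u} S
  cap : Sublanguage L
  lang : I → Sublanguage L
  cap_subset : ∀ i, cap.Subset (lang i)
  lang_inter : ∀ i j, i ≠ j → (lang i).inter (lang j) = cap
  funcs_union : ∀ (d : List S) (s : S) (f : L.Func d s), ∃ i, f ∈ (lang i).funcs d s
  rels_union : ∀ (d : List S) (R : L.Rel d), ∃ i, R ∈ (lang i).rels d
  T : ∀ i, Theory (lang i).lang
  Tcap : Theory cap.lang
  mem_Tcap : ∀ (i : I) (φ : Sentence cap.lang),
    φ ∈ Tcap ↔ (T i).Entails (φ.map (Sublanguage.inclOf (cap_subset i)))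
  consistent : Theory.Consistent {φ : Sentence L | ∃ i, ∃ ψ ∈ T i, φ = ψ.map (lang i).incl}

namespace FusionFamily

variable {S I : Type u} (F : FusionFamily S I)

/-- The union of the theories `T i`. -/
def Tcup : Theory F.L :=
  {φ | ∃ i, ∃ ψ ∈ F.T i, φ = ψ.map (F.lang i).incl}

/-- The reduct of an `L`-structure to the language with index `i`. -/
def red {M : S → Type w} (P : Interp F.L M) (i : I) : Interp (F.lang i).lang M :=
  P.reduct (F.lang i).incl

/-- The reduct of an `L`-structure to the common language. -/
def redCap {M : S → Type w} (P : Interp F.L M) : Interp F.cap.lang M :=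
  P.reduct F.cap.incl

/-- Interpolative structures. -/
def Interpolative {M : S → Type w} (P : Interp F.L M) : Prop :=
  ∀ (J : Finset I) (n : ℕ) (x : Fin n → S) (X : I → Set (∀ j, M (x j))),
    (∀ i ∈ J, Definable (F.red P i) (X i)) → (⋂ i ∈ J, X i) = ∅ →
    ∃ Y : I → Set (∀ j, M (x j)),
      (∀ i ∈ J, Definable (F.redCap P) (Y i) ∧ X i ⊆ Y i) ∧ (⋂ i ∈ J, Y i) = ∅

/-- The theory of the interpolative models of the union of the `T i`. -/
def Tstar : Theory F.L :=
  {φ | ∀ (M : S → Type u) (P : Interp F.L M), P.Models F.Tcup → F.Interpolative P → P.Holds φ}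

/-- The interpolative models of the union of the `T i` form an elementary class. -/
def FusionExists : Prop :=
  ∃ T' : Theory F.L, ∀ (M : S → Type u) (P : Interp F.L M),
    P.Models T' ↔ P.Models F.Tcup ∧ F.Interpolative P

/-- `Tcap` admits a stationary and extendable independence relation: for all completions `hT i`
of `T i` extending a common completion `hTcap` of `Tcap`, there is a stationary independence
relation in `hTcap` which is extendable to each `hT i`. Here `Q i` are monster models of
the `hT i` with a common reduct `Qcap`, a monster model of `hTcap`. -/
def AdmitsStationaryExtendable : Prop :=
  ∀ (hTcap : Theory F.cap.lang) (hT : ∀ i, Theory (F.lang i).lang),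
    Theory.IsCompletion F.Tcap hTcap →
    (∀ i, Theory.IsCompletion (F.T i) (hT i)) →
    (∀ i, ∀ φ ∈ hTcap, φ.map (Sublanguage.inclOf (F.cap_subset i)) ∈ hT i) →
    ∃ (M : S → Type (u + 1)) (Qcap : Interp F.cap.lang M)
      (Q : ∀ i, Interp (F.lang i).lang M) (ind : Sub M → Sub M → Sub M → Prop),
      (Qcap.Models hTcap ∧ IsMonster Qcap) ∧
      (∀ i, (Q i).Models (hT i) ∧ IsMonster (Q i)) ∧
      (∀ i, (Q i).reduct (Sublanguage.inclOf (F.cap_subset i)) = Qcap) ∧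
      StationaryIndep Qcap ind ∧ ∀ i, Extendable (Q i) ind

/-- Boolean combinations of `lang i`-formulas, where `i` may vary. -/
inductive BoolComb {V : Type v} {σ : V → S} : Formula F.L σ → Prop
  | of (i : I) (φ : Formula (F.lang i).lang σ) : BoolComb (φ.map (F.lang i).incl)
  | falsum : BoolComb .falsum
  | imp {φ ψ : Formula F.L σ} : BoolComb φ → BoolComb ψ → BoolComb (φ.imp ψ)

end FusionFamily

end ManySorted

/-!
The main point is that, in models of `F.Tstar`, the `F.L`-type of a tuple is determined by its
`lang i`-types (`FusionFamily.sameType_of_forall_sameType`); everything else follows from this by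
compactness and by combinatorics.

Let `a` in `M` and `b` in `N` have the same `lang i`-type for every `i`. First, the map from `a`
to `b` extends to `g : acl a → N` which is `lang i`-elementary for all `i` simultaneously
(`exists_closed_extension`). For each `i` there is an extension `G i`, and `G i` and `G j` differ
by a `cap`-elementary permutation of `acl a` over `a`, which is `lang i`-elementary by the
assumption on automorphisms. The domain of `g` is then closed under all functions of `F.L`, because
each function symbol belongs to some `lang i`. This settles atomic formulas. For quantifiers, the
type of a further element `m` of `M` has to be transported along `g` to an elementary extension of
`N`, that is, finitely many `lang i`-formulas `Φ i` which hold of `m` must have a common solution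
in `N` after transport (`exists_common_realization`). Otherwise, since `N` is interpolative, there
are `cap`-definable sets with empty intersection which contain the sets defined by the `Φ i`. In
monster models of the theories of the reducts of `N`, realize for each `i` the transported
`lang i`-type of `m` by an element independent from `N` over the domain of the type. The
`cap`-types over `N` of these elements are equal by stationarity, and this common type contains all
the `cap`-definable sets, a contradiction.

Hence all `F.L`-formulas are equivalent to Boolean combinations of `lang i`-formulas
(`exists_boolComb`). Stability and NIP pass to Boolean combinations, by Ramsey's theorem
(`OrderLike.of_imp`) and by the Sauer–Shelah lemma (`ShattersFinite.of_imp`) respectively. Finally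
a complete `F.L`-type over `A` is determined by its restrictions to the languages `lang i`, so that
there are at most `κ ^ #I` types if there are at most `κ` types in each `lang i`.

The logical background is developed as far as needed: substitution, Łoś's theorem and compactness
for many-sorted structures, in which sorts may be empty, and the behaviour of algebraic closure
under elementary embeddings. Counting quantifiers are avoided: algebraic closure commutes with
elementary embeddings because a finite definable set cannot grow, and it is idempotent because an
element of a small model which is not algebraic over `A` has a conjugate over `A` outside of the
model.
-/

namespace ManySorted

/-! ### Substitution, reducts and finite support of formulas -/

section Formulas

variable {S : Type u} {L L' : Language.{u} S}

/-- Simultaneous substitution of terms for the variables of a term. -/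
def Term.subst {V : Type v} {V' : Type w} {σ : V → S} {σ' : V' → S}
    (τ : ∀ x, Term L σ' (σ x)) : ∀ {s : S}, Term L σ s → Term L σ' s
  | _, .var x => τ x
  | _, .func f ts => .func f (fun k => (ts k).subst τ)

theorem Term.eval_subst {V : Type v} {V' : Type w} {σ : V → S} {σ' : V' → S}
    (τ : ∀ x, Term L σ' (σ x)) {M : S → Type w'} (I : Interp L M) (a : ∀ x, M (σ' x)) {s : S}
    (t : Term L σ s) : (t.subst τ).eval I a = t.eval I (fun x => (τ x).eval I a) := by
  induction t with
  | var x => rfl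
  | func f ts ih => simp only [Term.subst, Term.eval, ih]

/-- The sorts of the variables of a formula with free variables of sorts `σ` and bound variables
of sorts `Γ`. -/
abbrev ctx {V : Type v} (σ : V → S) (Γ : List S) : V ⊕ Fin Γ.length → S :=
  Sum.elim σ (fun k : Fin Γ.length => Γ.get k)

/-- The renaming of variables which makes room for one more bound variable. -/
def weaken {V : Type v} (σ : V → S) (Γ : List S) (s : S) :
    ∀ z : V ⊕ Fin Γ.length, Term L (ctx σ (s :: Γ)) (ctx σ Γ z)
  | .inl x => .var (σ := ctx σ (s :: Γ)) (.inl x)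
  | .inr k => .var (σ := ctx σ (s :: Γ)) (.inr k.succ)

theorem eval_weaken {V : Type v} {σ : V → S} {Γ : List S} {s : S} {M : S → Type w}
    (I : Interp L M) (a : ∀ x, M (σ x)) (e : ∀ k : Fin Γ.length, M (Γ.get k)) (m : M s)
    (z : V ⊕ Fin Γ.length) :
    (weaken (L := L) σ Γ s z).eval I
      (tupleSum a (Fin.cons (n := Γ.length) (α := fun k => M ((s :: Γ).get k)) m e)) =
      tupleSum a e z := by
  cases z <;> rfl

/-- The extension of a substitution under a quantifier. -/
def liftSubst {V : Type v} {V' : Type w} {σ : V → S} {σ' : V' → S} {Γ Γ' : List S} (s : S)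
    (τ : ∀ z, Term L (ctx σ' Γ') (ctx σ Γ z)) :
    ∀ z, Term L (ctx σ' (s :: Γ')) (ctx σ (s :: Γ) z)
  | .inl x => (τ (.inl x)).subst (weaken σ' Γ' s)
  | .inr k => Fin.cases (motive := fun k : Fin (Γ.length + 1) =>
        Term L (ctx σ' (s :: Γ')) ((s :: Γ).get k))
      (.var (σ := ctx σ' (s :: Γ')) (.inr (0 : Fin (Γ'.length + 1))))
      (fun k => (τ (.inr k)).subst (weaken σ' Γ' s)) k

theorem eval_liftSubst {V : Type v} {V' : Type w} {σ : V → S} {σ' : V' → S} {Γ Γ' : List S}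
    {s : S} (τ : ∀ z, Term L (ctx σ' Γ') (ctx σ Γ z)) {M : S → Type w'}
    (I : Interp L M) (a : ∀ x, M (σ' x)) (e : ∀ k : Fin Γ'.length, M (Γ'.get k)) (m : M s) :
    (fun z => (liftSubst s τ z).eval I
      (tupleSum a (Fin.cons (n := Γ'.length) (α := fun k => M ((s :: Γ').get k)) m e))) =
    tupleSum (σ := σ) (τ := fun k : Fin (s :: Γ).length => (s :: Γ).get k)
      (fun x => (τ (.inl x)).eval I (tupleSum a e))
      (Fin.cons (n := Γ.length) (α := fun k => M ((s :: Γ).get k)) m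
        (fun k => (τ (.inr k)).eval I (tupleSum a e))) := by
  funext z
  rcases z with x | k
  · exact (Term.eval_subst _ I _ (τ (.inl x))).trans
      (congrArg (fun b => (τ (.inl x)).eval I b) (funext (eval_weaken I a e m)))
  · refine Fin.cases ?_ (fun k => ?_) k
    · rfl
    · exact (Term.eval_subst _ I _ (τ (.inr k))).trans
        (congrArg (fun b => (τ (.inr k)).eval I b) (funext (eval_weaken I a e m)))

/-- Simultaneous substitution of terms for all variables, free or bound, of a formula. -/
def BForm.subst {V : Type v} {V' : Type w} {σ : V → S} {σ' : V' → S} :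
    ∀ {Γ Γ' : List S}, (∀ z, Term L (ctx σ' Γ') (ctx σ Γ z)) → BForm L σ Γ → BForm L σ' Γ'
  | _, _, _, .falsum => .falsum
  | _, _, τ, .equal t t' => .equal (t.subst τ) (t'.subst τ)
  | _, _, τ, .rel R ts => .rel R (fun k => (ts k).subst τ)
  | _, _, τ, .imp φ ψ => .imp (φ.subst τ) (ψ.subst τ)
  | _, _, τ, .all s φ => .all s (φ.subst (liftSubst s τ))

theorem tupleSum_comp {M : S → Type w} {V : Type v} {V' : Type w'} {σ : V → S} {τ : V' → S}
    (a : ∀ z, M (Sum.elim σ τ z)) :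
    tupleSum (fun x => a (.inl x)) (fun y => a (.inr y)) = a := by
  funext z; cases z <;> rfl

theorem BForm.sat_subst {V : Type v} {V' : Type w} {σ : V → S} {σ' : V' → S} {M : S → Type w'}
    (I : Interp L M) (a : ∀ x, M (σ' x)) {Γ Γ' : List S} (φ : BForm L σ Γ)
    (τ : ∀ z, Term L (ctx σ' Γ') (ctx σ Γ z)) (e : ∀ k : Fin Γ'.length, M (Γ'.get k)) :
    (φ.subst τ).Sat I a e ↔
      φ.Sat I (fun x => (τ (.inl x)).eval I (tupleSum a e))
        (fun k => (τ (.inr k)).eval I (tupleSum a e)) := by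
  induction φ generalizing Γ' with
  | falsum => rfl
  | equal t t' =>
    simp only [BForm.subst, BForm.Sat, Term.eval_subst]
    exact iff_of_eq (congrArg (fun b => t.eval I b = t'.eval I b)
      (tupleSum_comp (fun z => (τ z).eval I (tupleSum a e))).symm)
  | rel R ts =>
    simp only [BForm.subst, BForm.Sat, Term.eval_subst]
    exact iff_of_eq (congrArg (fun b => I.relMap R fun k => (ts k).eval I b)
      (tupleSum_comp (fun z => (τ z).eval I (tupleSum a e))).symm)
  | imp φ ψ ihφ ihψ => simp only [BForm.subst, BForm.Sat, ihφ, ihψ]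
  | all s φ ih =>
    simp only [BForm.subst, BForm.Sat, ih]
    refine forall_congr' fun m => ?_
    have h := eval_liftSubst τ I a e m
    have h1 := fun x => congrFun h (.inl x)
    have h2 := fun x => congrFun h (.inr x)
    rw [show (fun x => ((liftSubst s τ) (Sum.inl x)).eval I (tupleSum a _)) = _ from funext h1,
      show (fun x => ((liftSubst s τ) (Sum.inr x)).eval I (tupleSum a _)) = _ from funext h2]
    rfl

/-- Terms in free variables only, as terms in free and bound variables. -/
def Term.free {V : Type v} {σ : V → S} {s : S} (t : Term L σ s) : Term L (ctx σ []) s :=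
  t.subst (σ' := ctx σ []) fun y => .var (σ := ctx σ []) (.inl y)

theorem Term.eval_free {V : Type v} {σ : V → S} {s : S} {M : S → Type w} (I : Interp L M)
    (a : ∀ x, M (σ x)) (e : ∀ k : Fin ([] : List S).length, M (([] : List S).get k))
    (t : Term L σ s) : t.free.eval I (tupleSum a e) = t.eval I a :=
  Term.eval_subst (σ' := ctx σ []) _ I _ t

/-- Substitution of terms for the free variables of a formula. -/
def BForm.substFree {V : Type v} {V' : Type w} {σ : V → S} {σ' : V' → S}
    (τ : ∀ x, Term L σ' (σ x)) (φ : Formula L σ) : Formula L σ' :=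
  φ.subst (Γ := []) (Γ' := []) fun
    | .inl x => (τ x).free
    | .inr k => k.elim0

theorem Interp.realize_substFree {V : Type v} {V' : Type w} {σ : V → S} {σ' : V' → S}
    {M : S → Type w'} (I : Interp L M) (a : ∀ x, M (σ' x)) (τ : ∀ x, Term L σ' (σ x))
    (φ : Formula L σ) :
    I.Realize (φ.substFree τ) a ↔ I.Realize φ (fun x => (τ x).eval I a) := by
  unfold Interp.Realize BForm.substFree
  rw [BForm.sat_subst]
  apply iff_of_eq
  congr 1
  · exact funext fun x => Term.eval_free I a _ (τ x)
  · exact funext fun k => k.elim0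

instance {V : Type v} {σ : V → S} {Γ : List S} : Inhabited (BForm L σ Γ) := ⟨.falsum⟩

/-- The conjunction of a list of formulas. -/
def BForm.conj {V : Type v} {σ : V → S} : List (Formula L σ) → Formula L σ
  | [] => .neg .falsum
  | φ :: l => .neg (.imp φ (.neg (BForm.conj l)))

section Realize
variable {V : Type v} {σ : V → S} {M : S → Type w} (I : Interp L M) (a : ∀ x, M (σ x))

@[simp] theorem Interp.realize_falsum : I.Realize (.falsum : Formula L σ) a ↔ False := Iff.rfl

@[simp] theorem Interp.realize_imp (φ ψ : Formula L σ) :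
    I.Realize (φ.imp ψ) a ↔ (I.Realize φ a → I.Realize ψ a) := Iff.rfl

@[simp] theorem Interp.realize_neg (φ : Formula L σ) :
    I.Realize φ.neg a ↔ ¬ I.Realize φ a := Iff.rfl

@[simp] theorem Interp.realize_conj (l : List (Formula L σ)) :
    I.Realize (BForm.conj l) a ↔ ∀ φ ∈ l, I.Realize φ a := by
  induction l with
  | nil => simp [BForm.conj]
  | cons φ l ih => simp [BForm.conj, ih]

/-- The equation between two terms in free variables only. -/
def Term.eqForm {s : S} (t t' : Term L σ s) : Formula L σ :=
  .equal t.free t'.free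

@[simp] theorem Interp.realize_eqForm {s : S} (t t' : Term L σ s) :
    I.Realize (t.eqForm t') a ↔ t.eval I a = t'.eval I a := by
  unfold Interp.Realize Term.eqForm
  simp only [BForm.Sat, Term.eval_free]

/-- The application of a relation symbol to terms in free variables only. -/
def relForm {d : List S} (R : L.Rel d) (ts : ∀ k : Fin d.length, Term L σ (d.get k)) :
    Formula L σ :=
  .rel R fun k => (ts k).free

@[simp] theorem Interp.realize_relForm {d : List S} (R : L.Rel d)
    (ts : ∀ k : Fin d.length, Term L σ (d.get k)) :
    I.Realize (relForm R ts) a ↔ I.relMap R (fun k => (ts k).eval I a) := by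
  unfold Interp.Realize relForm
  simp only [BForm.Sat, Term.eval_free]

end Realize

theorem Term.eval_map (h : LHom L L') {V : Type v} {σ : V → S} {M : S → Type w}
    (I : Interp L' M) (a : ∀ x, M (σ x)) {s : S} (t : Term L σ s) :
    (t.map h).eval I a = t.eval (I.reduct h) a := by
  induction t with
  | var x => rfl
  | func f ts ih => simp only [Term.map, Term.eval, ih]; rfl

theorem BForm.sat_map (h : LHom L L') {V : Type v} {σ : V → S} {M : S → Type w}
    (I : Interp L' M) (a : ∀ x, M (σ x)) {Γ : List S} (φ : BForm L σ Γ)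
    (e : ∀ k : Fin Γ.length, M (Γ.get k)) :
    (φ.map h).Sat I a e ↔ φ.Sat (I.reduct h) a e := by
  induction φ with
  | falsum => rfl
  | equal t t' => simp only [BForm.map, BForm.Sat, Term.eval_map]
  | rel R ts => simp only [BForm.map, BForm.Sat, Term.eval_map]; rfl
  | imp φ ψ ihφ ihψ => simp only [BForm.map, BForm.Sat, ihφ, ihψ]
  | all s φ ih => simp only [BForm.map, BForm.Sat, ih]

theorem Interp.realize_map (h : LHom L L') {V : Type v} {σ : V → S} {M : S → Type w}
    (I : Interp L' M) (a : ∀ x, M (σ x)) (φ : Formula L σ) :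
    I.Realize (φ.map h) a ↔ (I.reduct h).Realize φ a :=
  BForm.sat_map h I a φ _

/-- The inclusion of the variables in `K` and the bound variables into all variables. -/
def inclSubst {V : Type v} (σ : V → S) (K : Set V) (Γ : List S) :
    ∀ z, Term L (ctx σ Γ) (ctx (fun x : K => σ x) Γ z)
  | .inl x => .var (σ := ctx σ Γ) (.inl x.1)
  | .inr k => .var (σ := ctx σ Γ) (.inr k)

theorem liftSubst_inclSubst {V : Type v} (σ : V → S) (K : Set V) (Γ : List S) (s : S) :
    liftSubst (L := L) s (inclSubst σ K Γ) = inclSubst σ K (s :: Γ) := by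
  funext z
  rcases z with x | k
  · rfl
  · exact Fin.cases (motive := fun k : Fin (Γ.length + 1) =>
      liftSubst (L := L) s (inclSubst σ K Γ) (.inr k) = inclSubst σ K (s :: Γ) (.inr k))
      rfl (fun k => rfl) k

theorem Term.exists_restrict {V : Type v} {σ : V → S} {Γ : List S} {s : S}
    (t : Term L (ctx σ Γ) s) : ∃ l : List V, ∀ K : Set V, (∀ x ∈ l, x ∈ K) →
      ∃ t' : Term L (ctx (fun x : K => σ x) Γ) s, t = t'.subst (inclSubst σ K Γ) := by
  induction t with
  | var z =>
    rcases z with x | k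
    · exact ⟨[x], fun K h => ⟨.var (σ := ctx (fun x : K => σ x) Γ) (.inl ⟨x, h x (by simp)⟩), rfl⟩⟩
    · exact ⟨[], fun K _ => ⟨.var (σ := ctx (fun x : K => σ x) Γ) (.inr k), rfl⟩⟩
  | func f ts ih =>
    choose l hl using ih
    refine ⟨(List.finRange _).flatMap l, fun K hK => ?_⟩
    have h := fun k => hl k K fun x hx => hK x (by simpa using ⟨k, hx⟩)
    choose ts' hts' using h
    exact ⟨.func f ts', by rw [Term.subst, funext hts']⟩

/-- Only finitely many free variables occur in a formula. -/
theorem BForm.exists_restrict {V : Type v} {σ : V → S} {Γ : List S} (φ : BForm L σ Γ) :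
    ∃ l : List V, ∀ K : Set V, (∀ x ∈ l, x ∈ K) →
      ∃ φ' : BForm L (fun x : K => σ x) Γ, φ = φ'.subst (inclSubst σ K Γ) := by
  induction φ with
  | falsum => exact ⟨[], fun K _ => ⟨.falsum, rfl⟩⟩
  | equal t t' =>
    obtain ⟨l, hl⟩ := t.exists_restrict
    obtain ⟨l', hl'⟩ := t'.exists_restrict
    refine ⟨l ++ l', fun K hK => ?_⟩
    obtain ⟨r, hr⟩ := hl K fun x hx => hK x (by simp [hx])
    obtain ⟨r', hr'⟩ := hl' K fun x hx => hK x (by simp [hx])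
    exact ⟨.equal r r', by rw [BForm.subst, ← hr, ← hr']⟩
  | rel R ts =>
    choose l hl using fun k => (ts k).exists_restrict
    refine ⟨(List.finRange _).flatMap l, fun K hK => ?_⟩
    have h := fun k => hl k K fun x hx => hK x (by simpa using ⟨k, hx⟩)
    choose ts' hts' using h
    exact ⟨.rel R ts', by rw [BForm.subst, ← funext hts']⟩
  | imp φ ψ ihφ ihψ =>
    obtain ⟨l, hl⟩ := ihφ
    obtain ⟨l', hl'⟩ := ihψ
    refine ⟨l ++ l', fun K hK => ?_⟩
    obtain ⟨r, hr⟩ := hl K fun x hx => hK x (by simp [hx])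
    obtain ⟨r', hr'⟩ := hl' K fun x hx => hK x (by simp [hx])
    exact ⟨.imp r r', by rw [BForm.subst, ← hr, ← hr']⟩
  | all s φ ih =>
    obtain ⟨l, hl⟩ := ih
    refine ⟨l, fun K hK => ?_⟩
    obtain ⟨r, hr⟩ := hl K hK
    exact ⟨.all s r, by rw [BForm.subst, liftSubst_inclSubst, ← hr]⟩

theorem Interp.realize_inclSubst {V : Type v} {σ : V → S} {M : S → Type w} (I : Interp L M)
    (K : Set V) (φ : Formula L (fun x : K => σ x)) (a : ∀ x, M (σ x)) :
    I.Realize (φ.subst (inclSubst σ K [])) a ↔ I.Realize φ (fun x : K => a x) := by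
  unfold Interp.Realize
  rw [BForm.sat_subst]
  apply iff_of_eq
  congr 1

open Classical in
/-- The formula `∃ z, φ`, where `φ` is a formula in the variables `K`. -/
noncomputable def BForm.exVar {V : Type v} (σ : V → S) (z : V) {K K' : Set V}
    (h : ∀ x ∈ K, x ≠ z → x ∈ K') (φ : Formula L (fun x : K => σ x)) :
    Formula L (fun x : K' => σ x) :=
  .neg (.all (σ z) (.neg (φ.subst (Γ := []) (Γ' := [σ z]) fun
    | .inl x => if hx : x.1 = z then
        cast (by rw [← hx]; rfl)
          (Term.var (L := L) (σ := ctx (fun x : K' => σ x) [σ z]) (.inr (0 : Fin 1)))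
        else .var (σ := ctx (fun x : K' => σ x) [σ z]) (.inl ⟨x.1, h x.1 x.2 hx⟩)
    | .inr k => k.elim0)))

theorem Interp.realize_exVar {V : Type v} [DecidableEq V] {σ : V → S} {M : S → Type w} (I : Interp L M)
    (a : ∀ x, M (σ x)) (z : V) {K K' : Set V} (h : ∀ x ∈ K, x ≠ z → x ∈ K')
    (φ : Formula L (fun x : K => σ x)) :
    I.Realize (φ.exVar σ z h) (fun x : K' => a x) ↔
      ∃ m : M (σ z), I.Realize φ (fun x : K => Function.update a z m x) := by
  unfold Interp.Realize BForm.exVar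
  simp only [BForm.Sat, BForm.sat_subst, imp_false, not_forall, not_not]
  refine exists_congr fun m => ?_
  apply iff_of_eq
  congr 1
  · funext ⟨x, hx⟩
    by_cases h : x = z
    · subst h; simp; rfl
    · simp [h, Term.eval, tupleSum]
  · exact funext fun k => k.elim0

end Formulas

/-! ### Ultraproducts and compactness -/

section Ultraproduct

open Filter

variable {S : Type u} {G : Type w'} (U : Ultrafilter G) (M : G → S → Type w)

/-- Families of elements of the sets `M F s` which are defined for almost all `F`. Partial
families are needed since `M F s` may be empty for some `F`. -/
def PreUltra (s : S) : Type (max w w') :=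
  {f : ∀ F, Option (M F s) // ∀ᶠ F in (U : Filter G), ∃ y, f F = some y}

/-- Equality almost everywhere. -/
def preUltraSetoid (s : S) : Setoid (PreUltra U M s) where
  r f g := ∀ᶠ F in (U : Filter G), f.1 F = g.1 F
  iseqv :=
    { refl := fun _ => Eventually.of_forall fun _ => rfl
      symm := fun h => h.mono fun _ h => h.symm
      trans := fun h h' => (h.and h').mono fun _ h => h.1.trans h.2 }

/-- The ultraproduct of the sets `M F s`. -/
def Ultra (s : S) : Type (max w w') := Quotient (preUltraSetoid U M s)

variable {U M}

/-- The value at `F` of a chosen representative of `x` is defined and equal to `y`. -/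
def Ultra.At {s : S} (F : G) (x : Ultra U M s) (y : M F s) : Prop :=
  (Quotient.out x).1 F = some y

theorem Ultra.At.unique {s : S} {F : G} {x : Ultra U M s} {y y' : M F s} (h : x.At F y)
    (h' : x.At F y') : y = y' :=
  Option.some_injective _ (h.symm.trans h')

theorem Ultra.eventually_exists {s : S} (x : Ultra U M s) :
    ∀ᶠ F in (U : Filter G), ∃ y, x.At F y :=
  (Quotient.out x).2

theorem Ultra.eq_of_eventually {s : S} {x x' : Ultra U M s}
    (h : ∀ᶠ F in (U : Filter G), ∃ y, x.At F y ∧ x'.At F y) : x = x' := by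
  rw [← Quotient.out_eq x, ← Quotient.out_eq x']
  refine Quotient.sound (s := preUltraSetoid U M s) ?_
  exact h.mono fun F ⟨y, h, h'⟩ => Eq.trans h h'.symm

theorem Ultra.exists_of_eventually {s : S} (p : ∀ F, M F s → Prop)
    (h : ∀ᶠ F in (U : Filter G), ∃ y, p F y) :
    ∃ x : Ultra U M s, ∀ᶠ F in (U : Filter G), ∃ y, x.At F y ∧ p F y := by
  classical
  let f : PreUltra U M s := ⟨fun F => if h : ∃ y, p F y then some h.choose else none,
    h.mono fun F h => ⟨h.choose, by simp [h]⟩⟩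
  refine ⟨Quotient.mk (preUltraSetoid U M s) f, ?_⟩
  have hf : ∀ᶠ F in (U : Filter G),
      (Quotient.out (Quotient.mk (preUltraSetoid U M s) f)).1 F = f.1 F :=
    Quotient.mk_out (s := preUltraSetoid U M s) f
  filter_upwards [h, hf] with F h hf
  refine ⟨h.choose, ?_, h.choose_spec⟩
  refine hf.trans ?_
  simp [f, h]

variable {L : Language.{u} S} (I : ∀ F, Interp L (M F))

theorem Ultra.eventually_exists_tuple {d : List S} (x : ∀ k : Fin d.length, Ultra U M (d.get k)) :
    ∀ᶠ F in (U : Filter G), ∃ y : ∀ k : Fin d.length, M F (d.get k), ∀ k, (x k).At F (y k) := by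
  filter_upwards [eventually_all.2 fun k => (x k).eventually_exists] with F h
  choose y hy using h
  exact ⟨y, hy⟩

theorem Ultra.exists_funMap {d : List S} {s : S} (f : L.Func d s)
    (x : ∀ k : Fin d.length, Ultra U M (d.get k)) :
    ∃ z : Ultra U M s, ∀ᶠ F in (U : Filter G), ∃ y, z.At F y ∧
      ∃ ys : ∀ k : Fin d.length, M F (d.get k),
        (∀ k, (x k).At F (ys k)) ∧ y = (I F).funMap f ys :=
  Ultra.exists_of_eventually _
    ((Ultra.eventually_exists_tuple x).mono fun _ ⟨ys, h⟩ => ⟨_, ys, h, rfl⟩)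

variable (U) in
/-- The ultraproduct of the structures `I F`. -/
noncomputable def ultraInterp : Interp L (Ultra U M) where
  funMap f x := (Ultra.exists_funMap I f x).choose
  relMap R x := ∀ᶠ F in (U : Filter G), ∀ ys, (∀ k, (x k).At F (ys k)) → (I F).relMap R ys

theorem Ultra.at_eval {V : Type v} {σ : V → S} (a : ∀ x, Ultra U M (σ x))
    (D : ∀ F, (∀ x, M F (σ x)) → Prop)
    (hD : ∀ x, ∀ᶠ F in (U : Filter G), ∀ β, D F β → (a x).At F (β x)) {s : S} (t : Term L σ s) :
    ∀ᶠ F in (U : Filter G), ∀ β, D F β →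
      (t.eval (ultraInterp U I) a).At F (t.eval (I F) β) := by
  induction t with
  | var x => exact hD x
  | func f ts ih =>
    filter_upwards [eventually_all.2 ih,
      (Ultra.exists_funMap I f (fun k => (ts k).eval (ultraInterp U I) a)).choose_spec]
      with F h ⟨y, hy, ys, hys, e⟩ β hβ
    have : ys = fun k => (ts k).eval (I F) β := funext fun k => (hys k).unique (h k β hβ)
    subst this
    subst e
    exact hy

/-- Łoś's theorem. The free variables in `V` may be infinitely many, and are evaluated in each
factor; the bound variables are finitely many, and their values are defined in almost every
factor. -/
theorem sat_ultraInterp {V : Type v} {σ : V → S} (a : ∀ x, Ultra U M (σ x))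
    (α : ∀ F x, M F (σ x)) (hα : ∀ x, ∀ᶠ F in (U : Filter G), (a x).At F (α F x))
    {Γ : List S} (φ : BForm L σ Γ) (e : ∀ k : Fin Γ.length, Ultra U M (Γ.get k)) :
    φ.Sat (ultraInterp U I) a e ↔
      ∀ᶠ F in (U : Filter G), ∀ ε : ∀ k : Fin Γ.length, M F (Γ.get k),
        (∀ k, (e k).At F (ε k)) → φ.Sat (I F) (α F) ε := by
  have key : ∀ {Γ : List S} (e : ∀ k : Fin Γ.length, Ultra U M (Γ.get k)) {s : S}
      (t : Term L (ctx σ Γ) s), ∀ᶠ F in (U : Filter G), ∀ ε : ∀ k : Fin Γ.length, M F (Γ.get k),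
        (∀ k, (e k).At F (ε k)) → (t.eval (ultraInterp U I) (tupleSum a e)).At F
          (t.eval (I F) (tupleSum (α F) ε)) := by
    intro Γ e s t
    have := Ultra.at_eval I (tupleSum a e) (fun F β => ∃ ε : ∀ k : Fin Γ.length, M F (Γ.get k),
      (∀ k, (e k).At F (ε k)) ∧ β = tupleSum (α F) ε) ?_ t
    · exact this.mono fun F h ε hε => h _ ⟨ε, hε, rfl⟩
    · rintro (x | k)
      · filter_upwards [hα x] with F h β ⟨ε, _, hβ⟩
        subst hβ
        exact h
      · refine Eventually.of_forall fun F β => ?_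
        rintro ⟨ε, h, rfl⟩
        exact h k
  induction φ with
  | falsum =>
    refine ⟨False.elim, fun h => ?_⟩
    obtain ⟨F, h, ε, hε⟩ := (h.and (Ultra.eventually_exists_tuple e)).exists
    exact h ε hε
  | equal t t' =>
    constructor
    · intro h
      filter_upwards [key e t, key e t'] with F h1 h2 ε hε
      have h3 := h1 ε hε
      have h : t.eval (ultraInterp U I) (tupleSum a e) = t'.eval (ultraInterp U I) (tupleSum a e) :=
        h
      rw [h] at h3
      exact h3.unique (h2 ε hε)
    · intro h
      refine Ultra.eq_of_eventually ?_
      filter_upwards [h, key e t, key e t', Ultra.eventually_exists_tuple e] with F h h1 h2 ⟨ε, hε⟩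
      refine ⟨_, h1 ε hε, ?_⟩
      have h3 : t.eval (I F) (tupleSum (α F) ε) = t'.eval (I F) (tupleSum (α F) ε) := h ε hε
      rw [h3]
      exact h2 ε hε
  | rel R ts =>
    have hts := eventually_all.2 fun k => key e (ts k)
    constructor
    · intro h
      filter_upwards [h, hts] with F h h1 ε hε
      exact h _ fun k => h1 k ε hε
    · intro h
      change ∀ᶠ F in (U : Filter G), _
      filter_upwards [h, hts, Ultra.eventually_exists_tuple e] with F h h1 ⟨ε, hε⟩ ys hys
      have : ys = fun k => (ts k).eval (I F) (tupleSum (α F) ε) :=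
        funext fun k => (hys k).unique (h1 k ε hε)
      rw [this]
      exact h ε hε
  | imp φ ψ ihφ ihψ =>
    refine (imp_congr (ihφ e) (ihψ e)).trans (Ultrafilter.eventually_imp.symm.trans ?_)
    refine eventually_congr ?_
    filter_upwards [Ultra.eventually_exists_tuple e] with F ⟨ε, hε⟩
    refine ⟨fun h ε' hε' hφ => h (fun ε'' hε'' => ?_) ε' hε', fun h h' ε' hε' => h ε' hε' (h' ε' hε')⟩
    rw [show ε'' = ε' from funext fun k => (hε'' k).unique (hε' k)]
    exact hφ
  | @all Γ s φ ih =>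
    constructor
    · intro h
      by_contra hc
      rw [← Ultrafilter.eventually_not] at hc
      obtain ⟨m, hm⟩ := Ultra.exists_of_eventually (U := U) (M := M) (s := s) (fun F y =>
        ∃ ε : ∀ k : Fin Γ.length, M F (Γ.get k), (∀ k, (e k).At F (ε k)) ∧
          ¬ φ.Sat (I F) (α F) (Fin.cons (n := Γ.length) (α := fun k => M F ((s :: Γ).get k)) y ε))
        (by
          filter_upwards [hc] with F hc
          simp only [BForm.Sat, not_forall] at hc
          obtain ⟨ε, hε, y, hy⟩ := hc
          exact ⟨y, ε, hε, hy⟩)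
      have h1 := (ih _).1 (h m)
      obtain ⟨F, h1, y, hy, ε, hε, hn⟩ := (h1.and hm).exists
      refine hn (h1 _ fun k => ?_)
      exact Fin.cases (motive := fun k : Fin (Γ.length + 1) => Ultra.At F
        (Fin.cons (n := Γ.length) (α := fun k => Ultra U M ((s :: Γ).get k)) m e k)
        (Fin.cons (n := Γ.length) (α := fun k => M F ((s :: Γ).get k)) y ε k)) hy hε k
    · intro h m
      refine (ih _).2 ?_
      filter_upwards [h] with F h ε hε
      have := h (fun k => ε k.succ) (fun k => hε k.succ) (ε (0 : Fin (Γ.length + 1)))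
      refine Eq.mp ?_ this
      congr 1
      exact Fin.cons_self_tail (n := Γ.length) (α := fun k => M F ((s :: Γ).get k)) ε

theorem realize_ultraInterp {V : Type v} {σ : V → S} (a : ∀ x, Ultra U M (σ x))
    (α : ∀ F x, M F (σ x)) (hα : ∀ x, ∀ᶠ F in (U : Filter G), (a x).At F (α F x))
    (φ : Formula L σ) :
    (ultraInterp U I).Realize φ a ↔ ∀ᶠ F in (U : Filter G), (I F).Realize φ (α F) := by
  unfold Interp.Realize
  rw [sat_ultraInterp I a α hα]
  refine eventually_congr (Eventually.of_forall fun F => ⟨fun h => h _ fun k => k.elim0,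
    fun h ε _ => ?_⟩)
  rw [show ε = fun k => k.elim0 from funext fun k => k.elim0]
  exact h

/-- The compactness theorem, for formulas in possibly infinitely many variables. -/
theorem compactness {L : Language.{u} S} {V : Type u} {σ : V → S} (T : Theory L)
    (p : Set (Formula L σ))
    (hp : ∀ F : Finset (Formula L σ), (F : Set (Formula L σ)) ⊆ p →
      ∃ (M : S → Type u) (I : Interp L M) (a : ∀ x, M (σ x)), I.Models T ∧
        ∀ φ ∈ F, I.Realize φ a) :
    ∃ (M : S → Type u) (I : Interp L M) (a : ∀ x, M (σ x)), I.Models T ∧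
      ∀ φ ∈ p, I.Realize φ a := by
  classical
  have hp' : ∀ F : Finset p, ∃ (M : S → Type u) (I : Interp L M) (a : ∀ x, M (σ x)),
      I.Models T ∧ ∀ φ ∈ F, I.Realize φ.1 a := by
    intro F
    obtain ⟨M, I, a, hT, h⟩ := hp (F.image Subtype.val) (by
      intro φ hφ
      simp only [Finset.coe_image, Set.mem_image] at hφ
      obtain ⟨φ', _, rfl⟩ := hφ
      exact φ'.2)
    exact ⟨M, I, a, hT, fun φ hφ => h _ (Finset.mem_image_of_mem _ hφ)⟩
  choose M I α hT hα using hp'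
  let U : Ultrafilter (Finset p) := Ultrafilter.of atTop
  have hx : ∀ x, ∃ y : Ultra U M (σ x), ∀ᶠ F in (U : Filter _), y.At F (α F x) := by
    intro x
    obtain ⟨y, hy⟩ := Ultra.exists_of_eventually (U := U) (M := M) (s := σ x)
      (fun F y => y = α F x) (Eventually.of_forall fun F => ⟨_, rfl⟩)
    exact ⟨y, hy.mono fun F ⟨z, hz, e⟩ => e ▸ hz⟩
  choose a ha using hx
  refine ⟨Ultra U M, ultraInterp U I, a, fun φ hφ => ?_, fun φ hφ => ?_⟩
  · refine (realize_ultraInterp I _ (fun F x => x.elim) (fun x => x.elim) φ).2 ?_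
    exact Eventually.of_forall fun F => hT F φ hφ
  · refine (realize_ultraInterp I a α ha φ).2 ?_
    have h1 : ∀ᶠ F in (U : Filter (Finset p)), ({⟨φ, hφ⟩} : Finset p) ≤ F :=
      Ultrafilter.of_le (atTop : Filter (Finset p)) (eventually_ge_atTop _)
    exact h1.mono fun F hF => hα F ⟨φ, hφ⟩ (hF (Finset.mem_singleton_self _))

end Ultraproduct

/-! ### Equality of types -/

section Elementary

variable {S : Type u} {L L' : Language.{u} S}

section SameType

variable {M : S → Type*} {N : S → Type*} {N' : S → Type*} {I : Interp L M} {I' : Interp L N}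
  {I'' : Interp L N'} {V : Type*} {σ : V → S}

theorem SameType.symm {a : ∀ x, M (σ x)} {b : ∀ x, N (σ x)} (h : SameType I I' a b) :
    SameType I' I b a := fun φ => (h φ).symm

theorem SameType.trans {a : ∀ x, M (σ x)} {b : ∀ x, N (σ x)} {c : ∀ x, N' (σ x)}
    (h : SameType I I' a b) (h' : SameType I' I'' b c) : SameType I I'' a c :=
  fun φ => (h φ).trans (h' φ)

theorem SameType.of_imp {a : ∀ x, M (σ x)} {b : ∀ x, N (σ x)}
    (h : ∀ φ : Formula L σ, I.Realize φ a → I'.Realize φ b) : SameType I I' a b :=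
  fun φ => ⟨h φ, fun hb => by_contra fun ha => h φ.neg ha hb⟩

theorem SameType.subst {a : ∀ x, M (σ x)} {b : ∀ x, N (σ x)} (h : SameType I I' a b)
    {V' : Type*} {σ' : V' → S} (τ : ∀ x, Term L σ (σ' x)) :
    SameType I I' (fun x => (τ x).eval I a) (fun x => (τ x).eval I' b) := fun φ => by
  rw [← Interp.realize_substFree, ← Interp.realize_substFree]
  exact h _

theorem SameType.reduct {J : Interp L' M} {J' : Interp L' N} {a : ∀ x, M (σ x)}
    {b : ∀ x, N (σ x)} (h : SameType J J' a b) (r : LHom L L') :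
    SameType (J.reduct r) (J'.reduct r) a b := fun φ => by
  rw [← Interp.realize_map, ← Interp.realize_map]
  exact h _

theorem SameType.inl {W : Type*} {τ : W → S} {c : ∀ x, M (τ x)} {d : ∀ x, N (τ x)}
    {a : ∀ x, M (σ x)} {b : ∀ x, N (σ x)} (h : SameType I I' (tupleSum c a) (tupleSum d b)) :
    SameType I I' c d :=
  h.subst (σ' := τ) fun x => .var (σ := Sum.elim τ σ) (.inl x)

theorem SameType.holds {a : ∀ x, M (σ x)} {b : ∀ x, N (σ x)} (h : SameType I I' a b)
    (φ : Sentence L) : I.Holds φ ↔ I'.Holds φ := by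
  have h := h.subst (V' := Empty) (σ' := Empty.elim) (fun x => x.elim) φ
  rwa [show (fun x : Empty => (x.elim : Term L σ _).eval I a) = fun x => x.elim from
      funext fun x => x.elim,
    show (fun x : Empty => (x.elim : Term L σ _).eval I' b) = fun x => x.elim from
      funext fun x => x.elim] at h

theorem SameType.models {a : ∀ x, M (σ x)} {b : ∀ x, N (σ x)} (h : SameType I I' a b)
    {T : Theory L} (hT : I.Models T) : I'.Models T :=
  fun φ hφ => (h.holds φ).1 (hT φ hφ)

theorem SameType.eq_iff {a : ∀ x, M (σ x)} {b : ∀ x, N (σ x)} (h : SameType I I' a b)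
    {s : S} (t t' : Term L σ s) :
    t.eval I a = t'.eval I a ↔ t.eval I' b = t'.eval I' b := by
  simpa using h (t.eqForm t')

/-- If `a` and `b` have the same type, then formulas over `a` are satisfiable if and only if
the corresponding formulas over `b` are. The tuple to be found may be infinite. -/
theorem SameType.exists_realize {a : ∀ x, M (σ x)} {b : ∀ x, N (σ x)} (h : SameType I I' a b)
    {W : Type*} {τ : W → S} (φ : Formula L (Sum.elim τ σ)) (c : ∀ y, M (τ y))
    (hφ : I.Realize φ (tupleSum c a)) : ∃ d, I'.Realize φ (tupleSum d b) := by
  classical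
  have hne : ∀ y, Nonempty (N (τ y)) := fun y => by
    by_contra hy
    rw [not_nonempty_iff] at hy
    exact (h (.all (τ y) .falsum)).2 (fun m => hy.elim m) (c y)
  obtain ⟨l, hl⟩ := φ.exists_restrict
  -- the variables which occur in `φ` are those of `a` and those in the finite list `l`
  let K : List W → Set (W ⊕ V) := fun l => {z | ∀ y, z = .inl y → y ∈ l}
  have key : ∀ (l : List W) (φ : Formula L (fun z : K l => Sum.elim τ σ z)),
      I.Realize φ (fun z : K l => tupleSum c a z) →
        ∃ d : ∀ y, N (τ y), I'.Realize φ (fun z : K l => tupleSum d b z) := by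
    intro l
    induction l with
    | nil =>
      intro φ hφ
      let ρ : ∀ z : K [], Term L σ (Sum.elim τ σ z) := fun
        | ⟨.inl y, h⟩ => absurd (h y rfl) (by simp)
        | ⟨.inr x, h⟩ => .var x
      refine ⟨fun y => (hne y).some, ?_⟩
      have h1 := h (φ.substFree ρ)
      rw [Interp.realize_substFree, Interp.realize_substFree] at h1
      have e1 : (fun z => (ρ z).eval I a) = fun z : K [] => tupleSum c a z := by
        funext z
        rcases z with ⟨y | x, h⟩
        · exact absurd (h y rfl) (by simp)
        · rfl
      have e2 : (fun z => (ρ z).eval I' b) =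
          fun z : K [] => tupleSum (fun y => (hne y).some) b z := by
        funext z
        rcases z with ⟨y | x, h⟩
        · exact absurd (h y rfl) (by simp)
        · rfl
      rw [e1, e2] at h1
      exact h1.1 hφ
    | cons y₀ l ih =>
      intro φ hφ
      have hK : ∀ z ∈ K (y₀ :: l), z ≠ .inl y₀ → z ∈ K l := by
        rintro z hz hz' y rfl
        exact (List.mem_cons.1 (hz y rfl)).resolve_left fun e => hz' (by rw [e])
      obtain ⟨d, hd⟩ := ih (φ.exVar (Sum.elim τ σ) (.inl y₀) hK)
        ((I.realize_exVar (tupleSum c a) (.inl y₀) hK φ).2 ⟨tupleSum c a (.inl y₀), by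
          rwa [Function.update_eq_self]⟩)
      obtain ⟨m, hm⟩ := (I'.realize_exVar (tupleSum d b) (.inl y₀) hK φ).1 hd
      refine ⟨Function.update d y₀ m, ?_⟩
      have e : Function.update (tupleSum d b) (.inl y₀) m =
          tupleSum (σ := τ) (Function.update d y₀ m) b := by
        funext z
        rcases z with y | x
        · by_cases hy : y = y₀
          · subst hy
            exact (Function.update_self _ _ _).trans (Function.update_self (β := fun y => N (τ y))
              y m d).symm
          · exact (Function.update_of_ne (by simpa using hy) _ _).trans
              (Function.update_of_ne (β := fun y => N (τ y)) hy m d).symm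
        · simp [tupleSum]
      rwa [e] at hm
  obtain ⟨φ', rfl⟩ := hl (K (l.filterMap fun z => z.getLeft?)) (by
    rintro z hz y rfl
    simpa using hz)
  obtain ⟨d, hd⟩ := key _ φ' (by rwa [Interp.realize_inclSubst] at hφ)
  exact ⟨d, by rwa [Interp.realize_inclSubst]⟩

end SameType
end Elementary
/-! ### Elementary embeddings and monster models -/

section Monster

variable {S : Type u} {L : Language.{u} S}

/-- The element of the tuple of all elements of `M`. -/
abbrev allElts (M : S → Type w) : ∀ c : (Σ s, M s), M c.1 := fun c => c.2

/-- Elementary embeddings. -/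
def Elem {M : S → Type w} {N : S → Type w'} (I : Interp L M) (I' : Interp L N)
    (e : ∀ s, M s → N s) : Prop :=
  SameType I I' (allElts M) (fun c => e c.1 c.2)

section Elem

variable {M : S → Type w} {N : S → Type w'} {I : Interp L M} {I' : Interp L N}
  {e : ∀ s, M s → N s}

theorem Elem.sameType (he : Elem I I' e) {V : Type*} {σ : V → S} (a : ∀ x, M (σ x)) :
    SameType I I' a (fun x => e _ (a x)) :=
  he.subst (σ' := σ) fun x => .var (σ := fun c : (Σ s, M s) => c.1) ⟨σ x, a x⟩

theorem Elem.injective (he : Elem I I' e) (s : S) : Function.Injective (e s) := fun m m' h =>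
  (he.eq_iff (s := s) (.var (σ := fun c : (Σ s, M s) => c.1) ⟨s, m⟩)
    (.var (σ := fun c : (Σ s, M s) => c.1) ⟨s, m'⟩)).2 h

theorem Elem.models (he : Elem I I' e) {T : Theory L} (hT : I.Models T) : I'.Models T :=
  SameType.models he hT

theorem Elem.sameType_tupleSum (he : Elem I I' e) {V : Type*} {σ : V → S} (a : ∀ x, M (σ x))
    {W : Type*} {τ : W → S} (b : ∀ x, M (τ x)) :
    SameType I I' (tupleSum a b) (tupleSum (fun x => e _ (a x)) (fun x => e _ (b x))) := by
  have h := he.sameType (tupleSum a b)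
  rwa [show (fun x => e _ (tupleSum a b x)) =
    tupleSum (fun x => e _ (a x)) (fun x => e _ (b x)) by
      funext x; cases x <;> rfl] at h

end Elem

/-- A finitely satisfiable set of formulas over `N` is realized in an elementary extension. -/
theorem exists_elem_realize {N : S → Type u} (I : Interp L N) {J : Type u} {x : J → S}
    (p : Set (Formula L (Sum.elim x (fun c : (Σ s, N s) => c.1))))
    (hp : ∀ F : Finset (Formula L (Sum.elim x (fun c : (Σ s, N s) => c.1))), (F : Set _) ⊆ p →
      ∃ a : ∀ j, N (x j), ∀ φ ∈ F, I.Realize φ (tupleSum a (allElts N))) :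
    ∃ (N' : S → Type u) (I' : Interp L N') (e : ∀ s, N s → N' s) (a : ∀ j, N' (x j)),
      Elem I I' e ∧ ∀ φ ∈ p, I'.Realize φ (tupleSum a (fun c => e c.1 c.2)) := by
  classical
  let τ : ∀ c : (Σ s, N s), Term L (Sum.elim x (fun c : (Σ s, N s) => c.1)) c.1 :=
    fun c => .var (σ := Sum.elim x (fun c : (Σ s, N s) => c.1)) (.inr c)
  have hτ : ∀ {N' : S → Type u} (I' : Interp L N') (a : ∀ j, N' (x j)) (e : ∀ s, N s → N' s)
      (φ : Formula L (fun c : (Σ s, N s) => c.1)),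
      I'.Realize (φ.substFree τ) (tupleSum a (fun c => e c.1 c.2)) ↔
        I'.Realize φ (fun c => e c.1 c.2) := fun I' a e φ => Interp.realize_substFree I' _ τ φ
  obtain ⟨N', I', a, -, h⟩ := compactness (L := L) ∅
    (p ∪ {φ | ∃ χ, I.Realize χ (allElts N) ∧ φ = χ.substFree τ}) (by
      intro F hF
      obtain ⟨a, ha⟩ := hp (F.filter (· ∈ p)) (by intro φ; simp)
      refine ⟨N, I, tupleSum a (allElts N), fun φ hφ => hφ.elim, fun φ hφ => ?_⟩
      rcases hF hφ with h | ⟨χ, hχ, rfl⟩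
      · exact ha φ (by simp [hφ, h])
      · exact (hτ I a (fun _ m => m) χ).2 hχ)
  have e : a = tupleSum (fun j => a (.inl j))
      (fun c : (Σ s, N s) => (fun (s : S) (m : N s) => a (.inr ⟨s, m⟩)) c.1 c.2) := by
    funext z; cases z <;> rfl
  rw [e] at h
  refine ⟨N', I', fun s m => a (.inr ⟨s, m⟩), fun j => a (.inl j), SameType.of_imp fun φ hφ => ?_,
    fun φ hφ => h φ (.inl hφ)⟩
  exact (hτ I' _ (fun s m => a (.inr ⟨s, m⟩)) φ).1 (h _ (.inr ⟨φ, hφ, rfl⟩))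

theorem smallSub_tupleSet {M : S → Type (u + 1)} {V : Type u} {σ : V → S} (b : ∀ x, M (σ x)) :
    SmallSub (tupleSet b) := by
  refine small_of_surjective
    (f := fun x : V => (⟨σ x, b x, x, rfl⟩ : Σ s, (tupleSet b) s)) ?_
  rintro ⟨s, m, x, h⟩
  refine ⟨x, ?_⟩
  cases h
  rfl

/-- Monster models realize all types, in possibly infinitely many variables, over the
components of small tuples. -/
theorem IsMonster.exists_sameType {Q : S → Type (u + 1)} {K : Interp L Q} (hK : IsMonster K)
    {M : S → Type w} {I : Interp L M} {V W : Type u} {σ : V → S} {τ : W → S}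
    {a : ∀ x, M (σ x)} {b : ∀ x, Q (σ x)} (h : SameType I K a b) (c : ∀ y, M (τ y)) :
    ∃ d, SameType I K (tupleSum c a) (tupleSum d b) := by
  classical
  let C : Sub Q := tupleSet b
  let r : ∀ z, Term L (Sum.elim τ (fun c : (Σ s, C s) => c.1)) (Sum.elim τ σ z) := fun
    | .inl y => .var (σ := Sum.elim τ (fun c : (Σ s, C s) => c.1)) (.inl y)
    | .inr x => .var (σ := Sum.elim τ (fun c : (Σ s, C s) => c.1))
        (.inr ⟨σ x, b x, x, rfl⟩)
  have hr : ∀ (d : ∀ y, Q (τ y)) (φ : Formula L (Sum.elim τ σ)),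
      K.PRealize (A := C) (φ.substFree r) d ↔ K.Realize φ (tupleSum d b) := by
    intro d φ
    rw [Interp.PRealize, Interp.realize_substFree]
    apply iff_of_eq
    congr 1
    funext z
    cases z <;> rfl
  obtain ⟨d, hd⟩ := hK.saturated C (smallSub_tupleSet b) W τ
    {φ | ∃ χ, I.Realize χ (tupleSum c a) ∧ φ = χ.substFree r} (by
      intro F hF
      choose! f hf using hF
      obtain ⟨d, hd⟩ := h.exists_realize (.conj (F.toList.map f)) c (by
        rw [Interp.realize_conj]
        intro χ hχ
        simp only [List.mem_map, Finset.mem_toList] at hχ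
        obtain ⟨φ, hφ, rfl⟩ := hχ
        exact (hf hφ).1)
      refine ⟨d, fun φ hφ => ?_⟩
      rw [(hf hφ).2, hr]
      rw [Interp.realize_conj] at hd
      exact hd _ (List.mem_map.2 ⟨φ, by simpa using hφ, rfl⟩))
  exact ⟨d, SameType.of_imp fun φ hφ => (hr d φ).1 (hd _ ⟨φ, hφ, rfl⟩)⟩

/-- A partial elementary map into a monster model extends to an elementary embedding. -/
theorem IsMonster.exists_elem {Q : S → Type (u + 1)} {K : Interp L Q} (hK : IsMonster K)
    {M : S → Type u} {I : Interp L M} {V : Type u} {σ : V → S}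
    {a : ∀ x, M (σ x)} {b : ∀ x, Q (σ x)} (h : SameType I K a b) :
    ∃ e : ∀ s, M s → Q s, Elem I K e ∧ ∀ x, e _ (a x) = b x := by
  obtain ⟨d, hd⟩ := hK.exists_sameType h (allElts M)
  refine ⟨fun s m => d ⟨s, m⟩, hd.inl, fun x => ?_⟩
  exact (hd.eq_iff (s := σ x)
    (.var (σ := Sum.elim (fun c : (Σ s, M s) => c.1) σ) (.inl ⟨σ x, a x⟩))
    (.var (σ := Sum.elim (fun c : (Σ s, M s) => c.1) σ) (.inr x))).1 rfl

/-- In structures with the same theory, the empty tuples have the same type. -/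
theorem sameType_empty {M : S → Type w} {N : S → Type w'} {I : Interp L M} {I' : Interp L N}
    (h : ∀ φ : Sentence L, I.Holds φ → I'.Holds φ) :
    SameType I I' (x := fun x : PEmpty.{v + 1} => x.elim) (fun x => x.elim)
      (fun x => x.elim) := SameType.of_imp fun φ hφ => by
  let r : ∀ x : PEmpty.{v + 1}, Term L (V := Empty) Empty.elim (x.elim : S) := fun x => x.elim
  have h1 := h (φ.substFree r)
  unfold Interp.Holds at h1
  rw [Interp.realize_substFree, Interp.realize_substFree] at h1
  rw [show (fun x => (r x).eval I fun x => x.elim) = fun x => x.elim from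
      funext fun x => x.elim,
    show (fun x => (r x).eval I' fun x => x.elim) = fun x => x.elim from
      funext fun x => x.elim] at h1
  exact h1 hφ

theorem Automorphism.eval {M : S → Type w} {I : Interp L M} (g : Automorphism I) {V : Type v}
    {σ : V → S} (a : ∀ x, M (σ x)) {s : S} (t : Term L σ s) :
    t.eval I (fun x => g.toPerm _ (a x)) = g.toPerm _ (t.eval I a) := by
  induction t with
  | var x => rfl
  | func f ts ih => simp only [Term.eval, ih, g.map_fun]

theorem Automorphism.sat {M : S → Type w} {I : Interp L M} (g : Automorphism I) {V : Type v}
    {σ : V → S} (a : ∀ x, M (σ x)) {Γ : List S} (φ : BForm L σ Γ)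
    (e : ∀ k : Fin Γ.length, M (Γ.get k)) :
    φ.Sat I (fun x => g.toPerm _ (a x)) (fun k => g.toPerm _ (e k)) ↔ φ.Sat I a e := by
  have key : ∀ {Γ : List S} (e : ∀ k : Fin Γ.length, M (Γ.get k)) {s : S}
      (t : Term L (ctx σ Γ) s),
      t.eval I (tupleSum (fun x => g.toPerm _ (a x)) (fun k => g.toPerm _ (e k))) =
        g.toPerm _ (t.eval I (tupleSum a e)) := by
    intro Γ e s t
    rw [← g.eval]
    congr 1
    funext z
    cases z <;> rfl
  induction φ with
  | falsum => rfl
  | equal t t' => simp only [BForm.Sat]; rw [key, key]; exact (g.toPerm _).injective.eq_iff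
  | rel R ts => simp only [BForm.Sat]; simp only [key]; exact g.map_rel R _
  | imp φ ψ ihφ ihψ => simp only [BForm.Sat, ihφ, ihψ]
  | @all Γ s φ ih =>
    simp only [BForm.Sat]
    refine ((g.toPerm s).forall_congr fun m => ?_).symm
    refine (ih _).symm.trans (iff_of_eq ?_)
    congr 1
    funext k
    exact Fin.cases (motive := fun k : Fin (Γ.length + 1) => g.toPerm _
        ((Fin.cons (n := Γ.length) (α := fun k => M ((s :: Γ).get k)) m e :
          ∀ k, M ((s :: Γ).get k)) k) =
        (Fin.cons (n := Γ.length) (α := fun k => M ((s :: Γ).get k)) (g.toPerm s m)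
          (fun k => g.toPerm _ (e k)) : ∀ k, M ((s :: Γ).get k)) k) rfl (fun k => rfl) k

theorem Automorphism.elem {M : S → Type w} {I : Interp L M} (g : Automorphism I) :
    Elem I I (fun s => g.toPerm s) := fun φ => by
  unfold Interp.Realize
  rw [← g.sat]
  apply iff_of_eq
  congr 1
  exact funext fun k => k.elim0

end Monster

/-! ### Algebraic closure -/

section Acl

variable {S : Type u} {L : Language.{u} S}

/-- The image of a subset under a map. -/
def img {M : S → Type w} {N : S → Type w'} (e : ∀ s, M s → N s) (A : Sub M) : Sub N :=
  fun s => e s '' A s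

theorem subset_acl {M : S → Type w} (I : Interp L M) (A : Sub M) : A ≤ acl I A := fun s m hm => by
  let t : Term L (Sum.elim (fun _ : Unit => s) (fun c : (Σ s, A s) => c.1)) s :=
    .var (σ := Sum.elim (fun _ : Unit => s) (fun c : (Σ s, A s) => c.1)) (.inl ())
  let t' : Term L (Sum.elim (fun _ : Unit => s) (fun c : (Σ s, A s) => c.1)) s :=
    .var (σ := Sum.elim (fun _ : Unit => s) (fun c : (Σ s, A s) => c.1)) (.inr ⟨s, m, hm⟩)
  have h : ∀ b : M s, I.PRealize (A := A) (t.eqForm t') (fun _ => b) ↔ b = m := fun b => by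
    rw [Interp.PRealize, Interp.realize_eqForm]
    rfl
  refine ⟨t.eqForm t', (h m).2 rfl, ?_⟩
  simp only [h]
  exact Set.finite_singleton m

section Elem

variable {M : S → Type w} {N : S → Type w'} {I : Interp L M} {I' : Interp L N}
  {e : ∀ s, M s → N s}

/-- A formula over `M` with finitely many solutions has no further solutions in an elementary
extension. -/
theorem Elem.exists_eq_of_finite (he : Elem I I' e) {s : S}
    (φ : Formula L (Sum.elim (fun _ : Unit => s) (fun c : (Σ s, M s) => c.1)))
    (hf : {m : M s | I.Realize φ (tupleSum (fun _ => m) (allElts M))}.Finite) {q : N s}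
    (hq : I'.Realize φ (tupleSum (fun _ => q) (fun c => e c.1 c.2))) :
    ∃ m, I.Realize φ (tupleSum (fun _ => m) (allElts M)) ∧ e s m = q := by
  classical
  by_contra hc
  push Not at hc
  let ne : M s → Formula L (Sum.elim (fun _ : Unit => s) (fun c : (Σ s, M s) => c.1)) := fun m =>
    .neg (Term.eqForm (s := s)
      (.var (σ := Sum.elim (fun _ : Unit => s) (fun c : (Σ s, M s) => c.1)) (.inl ()))
      (.var (σ := Sum.elim (fun _ : Unit => s) (fun c : (Σ s, M s) => c.1)) (.inr ⟨s, m⟩)))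
  obtain ⟨d, hd⟩ := (SameType.symm he).exists_realize (.conj (φ :: hf.toFinset.toList.map ne))
    (fun _ : Unit => q) (by
      rw [Interp.realize_conj]
      intro χ hχ
      simp only [List.mem_cons, List.mem_map, Finset.mem_toList, Set.Finite.mem_toFinset] at hχ
      rcases hχ with rfl | ⟨m, hm, rfl⟩
      · exact hq
      · exact fun h => hc m hm ((Interp.realize_eqForm (s := s) I' _ _ _).1 h).symm)
  rw [Interp.realize_conj] at hd
  have h1 := hd φ (by simp)
  have h2 := hd (ne (d ())) (by
    simp only [List.mem_cons, List.mem_map, Finset.mem_toList, Set.Finite.mem_toFinset]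
    exact .inr ⟨_, h1, rfl⟩)
  exact h2 ((Interp.realize_eqForm (s := s) I _ _ _).2 rfl)

/-- Elementary embeddings commute with algebraic closure. -/
theorem Elem.acl_img (he : Elem I I' e) (A : Sub M) : acl I' (img e A) = img e (acl I A) := by
  have key : ∀ {s : S} (φ : PFormula L (fun _ : Unit => s) A)
      (φ' : PFormula L (fun _ : Unit => s) (img e A)),
      (∀ q : N s, I'.PRealize φ' (fun _ => q) ↔
        I'.Realize φ (tupleSum (fun _ => q) (fun c : (Σ s, A s) => e c.1 c.2))) →
      (∀ m : M s, I.PRealize φ (fun _ => m) ↔ I'.PRealize φ' (fun _ => e s m)) ∧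
      ({m : M s | I.PRealize φ (fun _ => m)}.Finite → ∀ q, I'.PRealize φ' (fun _ => q) →
        ∃ m, I.PRealize φ (fun _ => m) ∧ e s m = q) := by
    intro s φ φ' h
    refine ⟨fun m => ?_, fun hf q hq => ?_⟩
    · rw [h]
      exact he.sameType_tupleSum _ _ φ
    · rw [h] at hq
      let r : ∀ z, Term L (Sum.elim (fun _ : Unit => s) (fun c : (Σ s, M s) => c.1))
          (Sum.elim (fun _ : Unit => s) (fun c : (Σ s, A s) => c.1) z) := fun
        | .inl y => .var (σ := Sum.elim (fun _ : Unit => s) (fun c : (Σ s, M s) => c.1)) (.inl y)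
        | .inr c => .var (σ := Sum.elim (fun _ : Unit => s) (fun c : (Σ s, M s) => c.1))
            (.inr ⟨c.1, c.2⟩)
      have hr : ∀ m : M s, I.Realize (φ.substFree r) (tupleSum (fun _ => m) (allElts M)) ↔
          I.PRealize φ (fun _ => m) := by
        intro m
        rw [Interp.realize_substFree, Interp.PRealize]
        apply iff_of_eq
        congr 1
        funext z
        cases z <;> rfl
      obtain ⟨m, hm, hmq⟩ := he.exists_eq_of_finite (φ.substFree r) (by simpa only [hr] using hf)
        (q := q) (by
          rw [Interp.realize_substFree]
          refine Eq.mp ?_ hq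
          congr 1
          funext z
          cases z <;> rfl)
      exact ⟨m, (hr m).1 hm, hmq⟩
  funext s
  ext q
  constructor
  · rintro ⟨φ', hq, hf⟩
    choose f hf1 hf2 using fun c : (Σ s, (img e A) s) => c.2.2
    let r : ∀ z, Term L (Sum.elim (fun _ : Unit => s) (fun c : (Σ s, A s) => c.1))
        (Sum.elim (fun _ : Unit => s) (fun c : (Σ s, (img e A) s) => c.1) z) := fun
      | .inl y => .var (σ := Sum.elim (fun _ : Unit => s) (fun c : (Σ s, A s) => c.1)) (.inl y)
      | .inr c => .var (σ := Sum.elim (fun _ : Unit => s) (fun c : (Σ s, A s) => c.1))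
          (.inr ⟨c.1, f c, hf1 c⟩)
    obtain ⟨h1, h2⟩ := key (BForm.substFree r φ') φ' (fun q => by
      rw [Interp.realize_substFree, Interp.PRealize]
      apply iff_of_eq
      congr 1
      funext z
      rcases z with y | c
      · rfl
      · exact (hf2 c).symm)
    have hf' : {m : M s | I.PRealize (BForm.substFree r φ') (fun _ => m)}.Finite := by
      refine (hf.preimage (f := e s) (he.injective s).injOn).subset fun m hm => (h1 m).1 hm
    obtain ⟨m, hm, rfl⟩ := h2 hf' q hq
    exact ⟨m, ⟨_, hm, hf'⟩, rfl⟩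
  · rintro ⟨m, ⟨φ, hm, hf⟩, rfl⟩
    let r : ∀ z, Term L (Sum.elim (fun _ : Unit => s) (fun c : (Σ s, (img e A) s) => c.1))
        (Sum.elim (fun _ : Unit => s) (fun c : (Σ s, A s) => c.1) z) := fun
      | .inl y => .var (σ := Sum.elim (fun _ : Unit => s) (fun c : (Σ s, (img e A) s) => c.1))
          (.inl y)
      | .inr c => .var (σ := Sum.elim (fun _ : Unit => s) (fun c : (Σ s, (img e A) s) => c.1))
          (.inr ⟨c.1, e _ c.2, c.2, c.2.2, rfl⟩)
    obtain ⟨h1, h2⟩ := key φ (BForm.substFree r φ) (fun q => by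
      rw [Interp.PRealize, Interp.realize_substFree]
      apply iff_of_eq
      congr 1
      funext z
      cases z <;> rfl)
    refine ⟨_, (h1 m).1 hm, (hf.image (e s)).subset fun q hq => ?_⟩
    obtain ⟨m', hm', rfl⟩ := h2 hf q hq
    exact ⟨m', hm', rfl⟩

end Elem

/-- An element outside of the algebraic closure of `A` has a conjugate over `A` outside of any
given small model. Therefore algebraic closure is idempotent. -/
theorem acl_acl {M : S → Type u} {I : Interp L M} {Q : S → Type (u + 1)} {K : Interp L Q}
    (hK : IsMonster K) {e : ∀ s, M s → Q s} (he : Elem I K e) (A : Sub M) :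
    acl I (acl I A) = acl I A := by
  classical
  refine le_antisymm (fun s b hb => ?_) (subset_acl I _)
  by_contra hbA
  let C : Sub Q := tupleSet (fun c : (Σ s, M s) => e c.1 c.2)
  let x : PUnit.{u + 1} → S := fun _ => s
  let r : ∀ z, Term L (Sum.elim x (fun c : (Σ s, C s) => c.1))
      (Sum.elim (fun _ : Unit => s) (fun c : (Σ s, A s) => c.1) z) := fun
    | .inl y => .var (σ := Sum.elim x (fun c : (Σ s, C s) => c.1)) (.inl ⟨⟩)
    | .inr c => .var (σ := Sum.elim x (fun c : (Σ s, C s) => c.1))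
        (.inr ⟨c.1, e _ c.2, ⟨c.1, c.2⟩, rfl⟩)
  have hr : ∀ (φ : PFormula L (fun _ : Unit => s) A) (q : Q s),
      K.PRealize (A := C) (φ.substFree r) (fun _ => q) ↔
        K.Realize φ (tupleSum (fun _ => q) (fun c : (Σ s, A s) => e c.1 c.2)) := by
    intro φ q
    rw [Interp.PRealize, Interp.realize_substFree]
    apply iff_of_eq
    congr 1
    funext z
    cases z <;> rfl
  let ne : M s → PFormula L x C := fun m =>
    .neg (Term.eqForm (s := s)
      (.var (σ := Sum.elim x (fun c : (Σ s, C s) => c.1)) (.inl ⟨⟩))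
      (.var (σ := Sum.elim x (fun c : (Σ s, C s) => c.1)) (.inr ⟨s, e s m, ⟨s, m⟩, rfl⟩)))
  have hne : ∀ m (q : Q s), K.PRealize (ne m) (fun _ => q) ↔ q ≠ e s m := by
    intro m q
    exact not_congr (Interp.realize_eqForm (s := s) K _ _ _)
  obtain ⟨q, hq⟩ := hK.saturated C (smallSub_tupleSet _) PUnit.{u + 1} x
    ({φ | ∃ χ : PFormula L (fun _ : Unit => s) A, I.PRealize χ (fun _ => b) ∧
      φ = χ.substFree r} ∪ Set.range ne) (by
      intro F hF
      choose f hf using fun φ : {φ // φ ∈ F ∧ ∃ χ : PFormula L (fun _ : Unit => s) A,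
        I.PRealize χ (fun _ => b) ∧ φ = χ.substFree r} => φ.2.2
      choose g hg using fun φ : {φ // φ ∈ F ∧ φ ∈ Set.range ne} => φ.2.2
      have : Finite {φ // φ ∈ F ∧ ∃ χ : PFormula L (fun _ : Unit => s) A,
          I.PRealize χ (fun _ => b) ∧ φ = χ.substFree r} :=
        Finite.Set.subset (F : Set _) fun φ h => h.1
      have : Finite {φ // φ ∈ F ∧ φ ∈ Set.range ne} :=
        Finite.Set.subset (F : Set _) fun φ h => h.1
      cases nonempty_fintype {φ // φ ∈ F ∧ ∃ χ : PFormula L (fun _ : Unit => s) A,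
          I.PRealize χ (fun _ => b) ∧ φ = χ.substFree r}
      let ψ : PFormula L (fun _ : Unit => s) A := .conj (Finset.univ.toList.map f)
      have hψ : {m : M s | I.PRealize ψ (fun _ => m)}.Infinite := fun hfin =>
        hbA ⟨ψ, by
          rw [Interp.PRealize, Interp.realize_conj]
          intro χ hχ
          simp only [List.mem_map] at hχ
          obtain ⟨φ, -, rfl⟩ := hχ
          exact (hf φ).1, hfin⟩
      obtain ⟨m, hm, hm'⟩ := (hψ.sdiff (Set.finite_range g)).nonempty
      refine ⟨fun _ => e s m, fun φ hφ => ?_⟩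
      rcases hF hφ with h | h
      · have e : φ = _ := (hf ⟨φ, hφ, h⟩).2
        rw [e, hr]
        refine (he.sameType_tupleSum _ _ _).1 ?_
        have h1 : I.PRealize ψ (fun _ => m) := hm
        rw [Interp.PRealize, Interp.realize_conj] at h1
        exact h1 _ (List.mem_map.2 ⟨_, by simp, rfl⟩)
      · have e : _ = φ := hg ⟨φ, hφ, h⟩
        rw [← e, hne]
        intro h2
        exact hm' ⟨_, ((he.injective s) h2).symm⟩)
  have hqM : ∀ m, q ⟨⟩ ≠ e s m := fun m => (hne m _).1 (hq _ (.inr ⟨m, rfl⟩))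
  let y : PUnit.{u + 1} ⊕ (Σ s, A s) → S := Sum.elim x (fun c => c.1)
  have hsame : SameType K K (x := y) (tupleSum (fun _ => e s b) (fun c => e c.1 c.2))
      (tupleSum q (fun c => e c.1 c.2)) := by
    have h1 : SameType I K (x := Sum.elim (fun _ : Unit => s) (fun c : (Σ s, A s) => c.1))
        (tupleSum (fun _ => b) (fun c => (c.2 : M c.1)))
        (tupleSum (fun _ => q ⟨⟩) (fun c => e c.1 c.2)) :=
      SameType.of_imp fun φ hφ => (hr φ _).1 (hq _ (.inl ⟨φ, hφ, rfl⟩))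
    have h2 := (he.sameType_tupleSum (fun _ : Unit => b) (fun c : (Σ s, A s) => (c.2 : M c.1))).symm.trans h1
    have h3 := h2.subst (σ' := y) fun
      | .inl _ => .var (σ := Sum.elim (fun _ : Unit => s) (fun c : (Σ s, A s) => c.1)) (.inl ())
      | .inr c => .var (σ := Sum.elim (fun _ : Unit => s) (fun c : (Σ s, A s) => c.1)) (.inr c)
    refine fun φ => Iff.trans (iff_of_eq ?_) ((h3 φ).trans (iff_of_eq ?_)) <;>
    · congr 1
      funext z
      cases z <;> rfl
  obtain ⟨g, hg⟩ := hK.homogeneous _ _ _ _ hsame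
  have hgb : g.toPerm s (e s b) = q ⟨⟩ := hg (.inl ⟨⟩)
  have hgA : img (fun s => g.toPerm s) (img e A) = img e A := by
    funext s'
    refine (Set.image_image _ _ _).trans (Set.image_congr fun a ha => ?_)
    exact hg (.inr ⟨s', a, ha⟩)
  have h1 : acl K (acl K (img e A)) = img (fun s => g.toPerm s) (acl K (acl K (img e A))) := by
    rw [← g.elem.acl_img, ← g.elem.acl_img, hgA]
  rw [he.acl_img, he.acl_img] at h1
  have h2 : q ⟨⟩ ∈ img e (acl I (acl I A)) s := by
    rw [h1, ← hgb]
    exact ⟨_, ⟨b, hb, rfl⟩, rfl⟩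
  obtain ⟨m, -, hm⟩ := h2
  exact hqM m hm.symm

end Acl

/-! ### Common realizations in interpolative structures -/

theorem smallSub_img {S : Type u} {M : S → Type u} {Q : S → Type (u + 1)} (e : ∀ s, M s → Q s)
    (A : Sub M) : SmallSub (img e A) := by
  refine small_of_surjective
    (f := fun c : (Σ s, A s) => (⟨c.1, e _ c.2, c.2, c.2.2, rfl⟩ : Σ s, (img e A) s)) ?_
  rintro ⟨s, q, m, hm, rfl⟩
  exact ⟨⟨s, m, hm⟩, rfl⟩

namespace FusionFamily

variable {S I : Type u} {F : FusionFamily S I}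

theorem models_and_interpolative_of_models_Tstar (hexists : F.FusionExists) {M : S → Type u}
    {P : Interp F.L M} (hP : P.Models F.Tstar) : P.Models F.Tcup ∧ F.Interpolative P := by
  obtain ⟨T', hT'⟩ := hexists
  exact (hT' M P).1 fun φ hφ => hP φ fun M' P' h1 h2 => (hT' M' P').2 ⟨h1, h2⟩ φ hφ

theorem models_red {M : S → Type u} {P : Interp F.L M} (hP : P.Models F.Tcup) (i : I) :
    (F.red P i).Models (F.T i) := fun φ hφ =>
  (Interp.realize_map (F.lang i).incl P _ φ).1 (hP _ ⟨i, φ, hφ, rfl⟩)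

/-- The inclusion of the common language in the language with index `i`. -/
abbrev capIncl (F : FusionFamily S I) (i : I) : LHom F.cap.lang (F.lang i).lang :=
  Sublanguage.inclOf (F.cap_subset i)

variable (F) in
/-- Monster models of completions of the theories `T i` with a common reduct, which carries a
stationary independence relation extendable to all of them. -/
structure Monsters where
  Q : S → Type (u + 1)
  cap : Interp F.cap.lang Q
  str : ∀ i, Interp (F.lang i).lang Q
  ind : Sub Q → Sub Q → Sub Q → Prop
  cap_monster : IsMonster cap
  str_monster : ∀ i, IsMonster (str i)
  reduct_eq : ∀ i, (str i).reduct (F.capIncl i) = cap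
  stationary : StationaryIndep cap ind
  extendable : ∀ i, Extendable (str i) ind

theorem exists_monsters [Nonempty I] (hind : F.AdmitsStationaryExtendable) {N : S → Type u}
    {P : Interp F.L N} (hP : P.Models F.Tcup) :
    ∃ W : Monsters F, ∀ i φ, (F.red P i).Holds φ → (W.str i).Holds φ := by
  obtain ⟨i₀⟩ := ‹Nonempty I›
  have hmap : ∀ i (φ : Sentence F.cap.lang), (F.red P i).Holds (φ.map (F.capIncl i)) ↔
      (F.redCap P).Holds φ := fun i φ => Interp.realize_map _ _ _ _
  obtain ⟨Q, cap, str, ind, ⟨_, hcap⟩, hstr, hred, hst, hext⟩ := hind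
    {φ | (F.redCap P).Holds φ} (fun i => {φ | (F.red P i).Holds φ})
    ⟨fun φ hφ => (hmap i₀ φ).1 ((F.mem_Tcap i₀ φ).1 hφ N _ (models_red hP i₀)),
      ⟨N, _, fun φ hφ => hφ⟩, fun φ => em _⟩
    (fun i => ⟨fun φ hφ => models_red hP i φ hφ, ⟨N, _, fun φ hφ => hφ⟩, fun φ => em _⟩)
    (fun i φ hφ => (hmap i φ).2 hφ)
  exact ⟨⟨Q, cap, str, ind, hcap, fun i => (hstr i).2, hred, hst, hext⟩,
    fun i φ hφ => (hstr i).1 φ hφ⟩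

namespace Monsters

theorem exists_elem (W : Monsters F) {N : S → Type u} {P : Interp F.L N}
    (hW : ∀ i φ, (F.red P i).Holds φ → (W.str i).Holds φ) (i : I) :
    ∃ e : ∀ s, N s → W.Q s, Elem (F.red P i) (W.str i) e := by
  obtain ⟨e, he, -⟩ := (W.str_monster i).exists_elem (sameType_empty.{u, u, u, u + 1} (hW i))
  exact ⟨e, he⟩

theorem sameType_cap (W : Monsters F) {N : S → Type u} {P : Interp F.L N} {i : I} {V : Type*}
    {σ : V → S} {a : ∀ x, N (σ x)} {b : ∀ x, W.Q (σ x)}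
    (h : SameType (F.red P i) (W.str i) a b) : SameType (F.redCap P) W.cap a b := by
  have h1 := h.reduct (F.capIncl i)
  rw [W.reduct_eq i] at h1
  exact h1

end Monsters

theorem image_img {L : Language.{u} S} {N : S → Type u} {Q : S → Type (u + 1)} {K : Interp L Q}
    (g : Automorphism K) {e e' : ∀ s, N s → Q s} (h : ∀ s n, g.toPerm s (e s n) = e' s n)
    (A : Sub N) : g.image (img e A) = img e' A := by
  funext s
  exact (Set.image_image _ _ _).trans (Set.image_congr fun n _ => h s n)

/-- If `g` is elementary for all `lang i`, with algebraically closed domain `A`, then finitely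
many `lang i`-formulas over `A`, for various `i`, with a common solution, are transported by
`g` to formulas with a common solution. If not, there are `cap`-definable sets with empty
intersection which contain the solution sets of the transported formulas. For each `i`, realize
the `lang i`-type of `m` over the image of `g` by an element independent from the target `N`.
By stationarity, the `cap`-types of these elements over `N` are all equal, which is absurd since
each contains the corresponding `cap`-definable set. -/
theorem exists_common_realization [Nonempty I] (hexists : F.FusionExists)
    (hind : F.AdmitsStationaryExtendable) {M N : S → Type u} {P : Interp F.L M}
    {P' : Interp F.L N} (hP' : P'.Models F.Tstar) {A : Sub M} (hA : ∀ i, acl (F.red P i) A = A)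
    (hAcap : acl (F.redCap P) A = A) (g : ∀ s, A s → N s)
    (hg : ∀ i, SameType (F.red P i) (F.red P' i) (fun c : (Σ s, A s) => (c.2 : M c.1))
      (fun c => g c.1 c.2)) {s : S} (m : M s) (J : Finset I) (hJ : J.Nonempty)
    (Φ : ∀ i, PFormula (F.lang i).lang (fun _ : Unit => s) A)
    (hΦ : ∀ i ∈ J, (F.red P i).PRealize (Φ i) (fun _ => m)) :
    ∃ n : N s, ∀ i ∈ J, (F.red P' i).Realize (Φ i)
      (tupleSum (fun _ => n) (fun c => g c.1 c.2)) := by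
  classical
  by_contra hc
  obtain ⟨i₀, hi₀⟩ := hJ
  obtain ⟨hcup, hint⟩ := models_and_interpolative_of_models_Tstar hexists hP'
  let U : Sub N := fun s => Set.univ
  let σ : Fin 1 ⊕ (Σ s, U s) → S := Sum.elim (fun _ => s) (fun c => c.1)
  let r : ∀ i, ∀ z, Term (F.lang i).lang σ
      (Sum.elim (fun _ : Unit => s) (fun c : (Σ s, A s) => c.1) z) := fun i => fun
    | .inl _ => .var (σ := σ) (.inl 0)
    | .inr c => .var (σ := σ) (.inr ⟨c.1, g c.1 c.2, trivial⟩)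
  have hr : ∀ i {N' : S → Type (u + 1)} (K : Interp (F.lang i).lang N') (y : Fin 1 → N' s)
      (e : ∀ s, N s → N' s), K.Realize ((Φ i).substFree (r i))
        (tupleSum (σ := fun _ => s) y (fun c : (Σ s, U s) => e c.1 c.2)) ↔
      K.Realize (Φ i) (tupleSum (fun _ => y 0) (fun c => e _ (g c.1 c.2))) := by
    intro i N' K y e
    rw [Interp.realize_substFree]
    apply iff_of_eq
    congr 1
    funext z
    cases z <;> rfl
  have hr' : ∀ i (y : Fin 1 → N s), (F.red P' i).PRealize (A := U) ((Φ i).substFree (r i)) y ↔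
      (F.red P' i).Realize (Φ i) (tupleSum (fun _ => y 0) (fun c => g c.1 c.2)) := by
    intro i y
    rw [Interp.PRealize, Interp.realize_substFree]
    apply iff_of_eq
    congr 1
    funext z
    cases z <;> rfl
  obtain ⟨Y, hY, hYe⟩ := hint J 1 (fun _ => s)
    (fun i => {y | (F.red P' i).Realize (Φ i) (tupleSum (fun _ => y 0) (fun c => g c.1 c.2))})
    (fun i _ => ⟨(Φ i).substFree (r i), Set.ext fun y => (hr' i y).symm⟩) (by
      rw [Set.eq_empty_iff_forall_notMem]
      intro y hy
      simp only [Set.mem_iInter] at hy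
      exact hc ⟨y 0, hy⟩)
  have hθ : ∀ i ∈ J, ∃ θ : PFormula F.cap.lang (fun _ : Fin 1 => s) U,
      Y i = {a | (F.redCap P').PRealize θ a} := fun i hi => (hY i hi).1
  choose! θ hθ using hθ
  -- elementary embeddings of both structures into monster models, compatible with `g`
  obtain ⟨W, hW⟩ := exists_monsters hind hcup
  choose e' he' using W.exists_elem hW
  have h1 := fun i => (W.str_monster i).exists_elem ((hg i).trans ((he' i).sameType _))
  choose e he heg using h1
  have heg : ∀ i s (k : A s), e i s k = e' i s (g s k) := fun i s k => heg i ⟨s, k⟩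
  let gA : Sub N := fun s => Set.range (g s)
  have hC : ∀ i, img (e i) A = img (e' i) gA := by
    intro i
    funext s
    ext q
    constructor
    · rintro ⟨k, hk, rfl⟩
      exact ⟨_, ⟨⟨k, hk⟩, rfl⟩, (heg i s ⟨k, hk⟩).symm⟩
    · rintro ⟨_, ⟨k, rfl⟩, rfl⟩
      exact ⟨k, k.2, heg i s k⟩
  -- realizations which are independent from `N`
  let x : PUnit.{u + 1} → S := fun _ => s
  have h2 := fun i => W.extendable i PUnit.{u + 1} x (fun _ => e i s m) (img (e' i) U)
    (img (e' i) gA) (smallSub_img _ _) (smallSub_img _ _) (by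
      rw [← hC, (he i).acl_img, hA])
  choose c hc1 hc2 using h2
  have hc3 : ∀ i, SameType (F.red P i) (W.str i)
      (tupleSum (fun _ : Unit => m) (fun k : (Σ s, A s) => (k.2 : M k.1)))
      (tupleSum (fun _ : Unit => c i ⟨⟩) (fun k => e' i _ (g k.1 k.2))) := by
    intro i
    have h3 := SameType.subst (hc1 i)
      (σ' := Sum.elim (fun _ : Unit => s) (fun c : (Σ s, A s) => c.1)) fun
      | .inl _ => .var (σ := Sum.elim x (fun c : (Σ s, (img (e' i) gA) s) => c.1)) (.inl ⟨⟩)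
      | .inr k => .var (σ := Sum.elim x (fun c : (Σ s, (img (e' i) gA) s) => c.1))
          (.inr ⟨k.1, e' i _ (g k.1 k.2), _, ⟨k.2, rfl⟩, rfl⟩)
    refine ((he i).sameType_tupleSum _ _).trans (SameType.symm ?_)
    refine fun φ => Iff.trans (iff_of_eq ?_) ((h3 φ).trans (iff_of_eq ?_))
    · congr 1
      funext z
      cases z <;> rfl
    · congr 1
      funext z
      rcases z with z | k
      · rfl
      · exact (heg i k.1 k.2).symm
  -- automorphisms of the common reduct which identify the embeddings of `N`
  have he'cap : ∀ i, Elem (F.redCap P') W.cap (e' i) := fun i => W.sameType_cap (he' i)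
  have h4 := fun i => W.cap_monster.homogeneous (Σ s, N s) (fun c => c.1) _ _
    ((he'cap i).symm.trans (he'cap i₀))
  choose G hG using h4
  have hG : ∀ i s n, (G i).toPerm s (e' i s n) = e' i₀ s n := fun i s n => hG i ⟨s, n⟩
  let d : I → ∀ j, W.Q (x j) := fun i _ => (G i).toPerm s (c i ⟨⟩)
  have hd1 : ∀ i, W.ind (tupleSet (d i)) (img (e' i₀) U) (img (e' i₀) gA) := by
    intro i
    have h5 := (W.stationary.invariance _ _ _ (smallSub_tupleSet (c i)) (smallSub_img _ _)
      (smallSub_img _ _) (G i)).1 (hc2 i)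
    rw [image_img (G i) (hG i), image_img (G i) (hG i)] at h5
    rw [show tupleSet (d i) = (G i).image (tupleSet (c i)) from ?_]
    · exact h5
    · funext s'
      ext q
      constructor
      · rintro ⟨j, hj⟩
        cases hj
        exact ⟨c i ⟨⟩, ⟨⟨⟩, rfl⟩, rfl⟩
      · rintro ⟨q, ⟨j, hj⟩, rfl⟩
        cases hj
        exact ⟨⟨⟩, rfl⟩
  have hd2 : ∀ i, SameType (F.redCap P) W.cap
      (tupleSum (fun _ : Unit => m) (fun k : (Σ s, A s) => (k.2 : M k.1)))
      (tupleSum (fun _ : Unit => d i ⟨⟩) (fun k => e' i₀ _ (g k.1 k.2))) := by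
    intro i
    have h6 := (W.sameType_cap (hc3 i)).trans ((G i).elem.sameType_tupleSum _ _)
    simp only [hG] at h6
    exact h6
  have hd3 : ∀ i, SameTypeOver W.cap (img (e' i₀) gA) (d i) (d i₀) := by
    intro i
    choose k hk hk' using fun c : (Σ s, (img (e' i₀) gA) s) => c.2.2
    choose l hl using hk
    have h7 := ((hd2 i).symm.trans (hd2 i₀)).subst
      (σ' := Sum.elim x (fun c : (Σ s, (img (e' i₀) gA) s) => c.1)) fun
      | .inl _ => .var (σ := Sum.elim (fun _ : Unit => s) (fun c : (Σ s, A s) => c.1)) (.inl ())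
      | .inr c => .var (σ := Sum.elim (fun _ : Unit => s) (fun c : (Σ s, A s) => c.1))
          (.inr ⟨c.1, l c⟩)
    refine fun φ => Iff.trans (iff_of_eq ?_) ((h7 φ).trans (iff_of_eq ?_)) <;>
    · unfold Interp.PRealize
      congr 1
      funext z
      rcases z with z | c
      · rfl
      · first
        | exact (congrArg (e' i₀ c.1) (hl c)).trans (hk' c)
        | exact ((congrArg (e' i₀ c.1) (hl c)).trans (hk' c)).symm
  have hd4 : ∀ i, SameTypeOver W.cap (img (e' i₀) U ⊔ img (e' i₀) gA) (d i) (d i₀) := fun i =>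
    W.stationary.stationarity PUnit.{u + 1} x (d i) (d i₀) _ _ (smallSub_img _ _)
      (smallSub_img _ _) (by
        have h8 : Elem (F.redCap P) W.cap (e i₀) := W.sameType_cap (he i₀)
        rw [← hC, h8.acl_img, hAcap]) (hd3 i) (hd1 i) (hd1 i₀)
  have hd5 : ∀ i, SameType W.cap W.cap (x := σ)
      (tupleSum (σ := fun _ : Fin 1 => s) (fun _ => d i ⟨⟩) (fun c => e' i₀ c.1 c.2))
      (tupleSum (σ := fun _ : Fin 1 => s) (fun _ => d i₀ ⟨⟩) (fun c => e' i₀ c.1 c.2)) := by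
    intro i
    have h9 := SameType.subst (hd4 i) (σ' := σ) fun
      | .inl _ => .var (σ := Sum.elim x
          (fun c : (Σ s, (img (e' i₀) U ⊔ img (e' i₀) gA : Sub W.Q) s) => c.1)) (.inl ⟨⟩)
      | .inr c => .var (σ := Sum.elim x
          (fun c : (Σ s, (img (e' i₀) U ⊔ img (e' i₀) gA : Sub W.Q) s) => c.1))
          (.inr ⟨c.1, e' i₀ _ c.2, .inl ⟨_, trivial, rfl⟩⟩)
    refine fun φ => Iff.trans (iff_of_eq ?_) ((h9 φ).trans (iff_of_eq ?_)) <;>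
    · congr 1
      funext z
      cases z <;> rfl
  have hθ1 : ∀ i ∈ J, W.cap.Realize (θ i) (tupleSum (σ := fun _ : Fin 1 => s)
      (fun _ => c i ⟨⟩) (fun c => e' i c.1 c.2)) := by
    intro i hi
    by_contra hn
    obtain ⟨y, hy⟩ := ((he' i).sameType (fun c : (Σ s, U s) => (c.2 : N c.1))).symm.exists_realize
      (τ := fun _ : Fin 1 => s)
      (.conj [(Φ i).substFree (r i), .neg ((θ i).map (F.capIncl i))]) (fun _ => c i ⟨⟩) (by
        rw [Interp.realize_conj]
        simp only [List.mem_cons, List.not_mem_nil, or_false, forall_eq_or_imp, forall_eq]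
        refine ⟨(hr i _ _ _).2 ((hc3 i (Φ i)).1 (hΦ i hi)), ?_⟩
        rw [Interp.realize_neg, Interp.realize_map, W.reduct_eq]
        exact hn)
    rw [Interp.realize_conj] at hy
    simp only [List.mem_cons, List.not_mem_nil, or_false, forall_eq_or_imp, forall_eq] at hy
    obtain ⟨hy1, hy2⟩ := hy
    rw [Interp.realize_neg, Interp.realize_map] at hy2
    have h10 := (hY i hi).2 ((hr' i y).1 hy1)
    rw [hθ i hi] at h10
    exact hy2 h10
  have hθ2 : ∀ i ∈ J, W.cap.Realize (θ i) (tupleSum (σ := fun _ : Fin 1 => s)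
      (fun _ => d i₀ ⟨⟩) (fun c => e' i₀ c.1 c.2)) := by
    intro i hi
    refine (hd5 i (θ i)).1 ?_
    have h11 := ((G i).elem.sameType_tupleSum (σ := fun _ : Fin 1 => s) (fun _ => c i ⟨⟩)
      (fun c : (Σ s, U s) => e' i c.1 c.2) (θ i)).1 (hθ1 i hi)
    simp only [hG] at h11
    exact h11
  obtain ⟨y, hy⟩ := ((he'cap i₀).sameType
    (fun c : (Σ s, U s) => (c.2 : N c.1))).symm.exists_realize (τ := fun _ : Fin 1 => s)
    (.conj (J.toList.map θ)) (fun _ => d i₀ ⟨⟩) (by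
      rw [Interp.realize_conj]
      intro χ hχ
      simp only [List.mem_map, Finset.mem_toList] at hχ
      obtain ⟨i, hi, rfl⟩ := hχ
      exact hθ2 i hi)
  rw [Interp.realize_conj] at hy
  have : y ∈ ⋂ i ∈ J, Y i := by
    simp only [Set.mem_iInter]
    intro i hi
    rw [hθ i hi]
    exact hy (θ i) (List.mem_map.2 ⟨i, by simpa using hi, rfl⟩)
  rw [hYe] at this
  exact this

end FusionFamily

/-! ### Types in models of the fusion are determined by types in the given languages -/

section

variable {S : Type u} {L : Language.{u} S}

theorem img_tupleSet {M : S → Type w} {N : S → Type w'} (e : ∀ s, M s → N s) {V : Type v}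
    {σ : V → S} (a : ∀ x, M (σ x)) : img e (tupleSet a) = tupleSet (fun x => e _ (a x)) := by
  funext s
  ext q
  constructor
  · rintro ⟨m, ⟨x, hx⟩, rfl⟩
    cases hx
    exact ⟨x, rfl⟩
  · rintro ⟨x, hx⟩
    cases hx
    exact ⟨a x, ⟨x, rfl⟩, rfl⟩

/-- Structures in which two tuples have the same type agree on formulas with some variables
regarded as bound. -/
theorem SameType.sat_iff {M : S → Type w} {N : S → Type w'} {K : Interp L M} {K' : Interp L N}
    {V : Type v} {σ : V → S} {Γ : List S} {a : ∀ x, M (σ x)} {b : ∀ x, N (σ x)}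
    {e : ∀ k : Fin Γ.length, M (Γ.get k)} {e' : ∀ k : Fin Γ.length, N (Γ.get k)}
    (h : SameType K K' (x := ctx σ Γ) (tupleSum a e) (tupleSum b e')) (φ : BForm L σ Γ) :
    φ.Sat K a e ↔ φ.Sat K' b e' := by
  let τ : ∀ z, Term L (ctx (ctx σ Γ) []) (ctx σ Γ z) :=
    fun z => .var (σ := ctx (ctx σ Γ) []) (.inl z)
  exact (BForm.sat_subst K (tupleSum a e) φ τ _).symm.trans
    ((h (φ.subst τ)).trans (BForm.sat_subst K' (tupleSum b e') φ τ _))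

end

namespace FusionFamily

variable {S I : Type u} {F : FusionFamily S I}

/-- If `a` and `b` have the same `lang i`-types for all `i`, then the map from `a` to `b` extends
to the algebraic closure of `a`, and the extension is elementary for all `lang i`
simultaneously. There is an extension `G i` for each `i`. The two extensions `G i` and `G j`
differ by a `cap`-elementary permutation, which is `lang i`-elementary by assumption. -/
theorem exists_closed_extension [Nonempty I] (hexists : F.FusionExists)
    (hind : F.AdmitsStationaryExtendable)
    (hacl : ∀ (M : S → Type u) (P : Interp F.L M), P.Models F.Tstar →
      ∀ (A : Sub M) (i : I), acl (F.red P i) A = acl (F.redCap P) A ∧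
        autOver (F.redCap P) (acl (F.redCap P) A) A = autOver (F.red P i) (acl (F.redCap P) A) A)
    {M N : S → Type u} {P : Interp F.L M} {P' : Interp F.L N} (hP : P.Models F.Tstar)
    (hP' : P'.Models F.Tstar) {V : Type u} {σ : V → S} {a : ∀ x, M (σ x)} {b : ∀ x, N (σ x)}
    (h : ∀ i, SameType (F.red P i) (F.red P' i) a b) :
    ∃ (A : Sub M) (g : ∀ s, A s → N s), (∀ i, acl (F.red P i) A = A) ∧
      acl (F.redCap P) A = A ∧
      (∀ i, SameType (F.red P i) (F.red P' i) (fun c : (Σ s, A s) => (c.2 : M c.1))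
        (fun c => g c.1 c.2)) ∧
      ∀ x, ∃ hx : a x ∈ A (σ x), g _ ⟨a x, hx⟩ = b x := by
  obtain ⟨i₀⟩ := id ‹Nonempty I›
  obtain ⟨hcup, -⟩ := models_and_interpolative_of_models_Tstar hexists hP'
  obtain ⟨W, hW⟩ := exists_monsters hind hcup
  choose e' he' using W.exists_elem hW
  have h1 := fun i => (W.str_monster i).exists_elem ((h i).trans ((he' i).sameType b))
  choose e he heb using h1
  let A : Sub M := acl (F.redCap P) (tupleSet a)
  let B : Sub N := acl (F.redCap P') (tupleSet b)
  have hA : ∀ i, acl (F.red P i) (tupleSet a) = A := fun i => (hacl M P hP _ i).1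
  have hB : ∀ i, acl (F.red P' i) (tupleSet b) = B := fun i => (hacl N P' hP' _ i).1
  have himg : ∀ i, img (e i) A = img (e' i) B := by
    intro i
    rw [← hA i, ← hB i, ← (he i).acl_img, ← (he' i).acl_img, img_tupleSet, img_tupleSet,
      funext (heb i)]
  have hGex : ∀ i, ∃ G : ∀ s, A s ≃ B s, ∀ s k, e' i s (G s k) = e i s k := by
    intro i
    have h2 : ∀ s (k : A s), ∃ l : B s, e' i s l = e i s k := by
      intro s k
      have h3 : e i s k ∈ img (e' i) B s := by
        rw [← himg i]
        exact ⟨k, k.2, rfl⟩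
      obtain ⟨l, hl, h4⟩ := h3
      exact ⟨⟨l, hl⟩, h4⟩
    choose f hf using h2
    refine ⟨fun s => Equiv.ofBijective (f s) ⟨fun k k' hk => ?_, fun l => ?_⟩, hf⟩
    · refine Subtype.ext ((he i).injective s ?_)
      rw [← hf, ← hf, hk]
    · have h3 : e' i s l ∈ img (e i) A s := by
        rw [himg i]
        exact ⟨l, l.2, rfl⟩
      obtain ⟨k, hk, h4⟩ := h3
      exact ⟨⟨k, hk⟩, Subtype.ext ((he' i).injective s ((hf s ⟨k, hk⟩).trans h4))⟩
  choose G hG using hGex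
  have hGs : ∀ i, SameType (F.red P i) (F.red P' i) (fun c : (Σ s, A s) => (c.2 : M c.1))
      (fun c => (G i c.1 c.2 : N c.1)) := by
    intro i
    have h5 := (he' i).sameType (fun c : (Σ s, A s) => (G i c.1 c.2 : N c.1))
    simp only [hG] at h5
    exact ((he i).sameType _).trans h5.symm
  have hGb : ∀ i x, (G i (σ x) ⟨a x, subset_acl _ _ _ ⟨x, rfl⟩⟩ : N (σ x)) = b x :=
    fun i x => (he' i).injective _ ((hG i _ _).trans (heb i x))
  have hAA : ∀ i, acl (F.red P i) A = A := by
    intro i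
    rw [← hA i]
    exact acl_acl (W.str_monster i) (he i) _
  refine ⟨A, fun s k => G i₀ s k, hAA, ((hacl M P hP A i₀).1.symm.trans (hAA i₀)), fun i => ?_,
    fun x => ⟨subset_acl _ _ _ ⟨x, rfl⟩, hGb i₀ x⟩⟩
  -- the permutation by which `G i₀` and `G i` differ
  let π : ∀ s, Equiv.Perm (A s) := fun s => (G i₀ s).trans (G i s).symm
  have hπG : ∀ s k, G i s (π s k) = G i₀ s k := fun s k => (G i s).apply_symm_apply _
  have hre : SameType (F.red P i) (F.red P' i)
      (fun c : (Σ s, A s) => (π c.1 c.2 : M c.1)) (fun c => (G i₀ c.1 c.2 : N c.1)) := by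
    have h6 := (hGs i).subst (σ' := fun c : (Σ s, A s) => c.1)
      fun c => .var (σ := fun c : (Σ s, A s) => c.1) ⟨c.1, π c.1 c.2⟩
    simp only [Term.eval, hπG] at h6
    exact h6
  have hπ : π ∈ autOver (F.redCap P) A (tupleSet a) := by
    refine ⟨SameType.trans ((hGs i₀).reduct (F.capIncl i₀)) (hre.reduct (F.capIncl i)).symm, ?_⟩
    rintro s k ⟨x, hx⟩
    obtain ⟨k, hk⟩ := k
    cases hx
    refine (G i _).injective (Subtype.ext ?_)
    rw [hπG]
    exact (hGb i₀ x).trans (hGb i x).symm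
  rw [(hacl M P hP _ i).2] at hπ
  exact hπ.1.trans hre

/-- A subset which is algebraically closed for all `lang i` is closed under all terms, and maps
which are elementary for all `lang i` commute with terms. -/
theorem eval_mem_of_acl_eq {M N : S → Type u} {P : Interp F.L M} {P' : Interp F.L N} {A : Sub M}
    {g : ∀ s, A s → N s} (hA : ∀ i, acl (F.red P i) A = A)
    (hg : ∀ i, SameType (F.red P i) (F.red P' i) (fun c : (Σ s, A s) => (c.2 : M c.1))
      (fun c => g c.1 c.2)) {V : Type v} {σ : V → S} (a : ∀ x, A (σ x)) {s : S}
    (t : Term F.L σ s) :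
    ∃ h : t.eval P (fun x => (a x : M (σ x))) ∈ A s,
      g s ⟨_, h⟩ = t.eval P' (fun x => g _ (a x)) := by
  induction t with
  | var x => exact ⟨(a x).2, rfl⟩
  | @func d s f ts ih =>
    obtain ⟨i, hf⟩ := F.funcs_union d s f
    choose hv hgv using ih
    let v : ∀ k, A (d.get k) := fun k => ⟨_, hv k⟩
    have hmem : P.funMap f (fun k => (v k : M (d.get k))) ∈ A s := by
      refine (congrFun (hA i) s).subset ?_
      let σ' : Unit ⊕ (Σ s, A s) → S := Sum.elim (fun _ => s) (fun c => c.1)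
      let t₁ : Term (F.lang i).lang σ' s := .var (σ := σ') (.inl ())
      let t₂ : Term (F.lang i).lang σ' s := .func (L := (F.lang i).lang) ⟨f, hf⟩
        (fun k => .var (σ := σ') (.inr ⟨_, v k⟩))
      have h1 : ∀ m : M s, (F.red P i).PRealize (A := A) (x := fun _ : Unit => s) (t₁.eqForm t₂)
          (fun _ => m) ↔ m = P.funMap f (fun k => (v k : M (d.get k))) := fun m =>
        Interp.realize_eqForm _ _ t₁ t₂
      refine ⟨t₁.eqForm t₂, (h1 _).2 rfl, ?_⟩
      simp only [h1]
      exact Set.finite_singleton _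
    refine ⟨hmem, ?_⟩
    have h2 := ((hg i).eq_iff (s := s)
      (.var (σ := fun c : (Σ s, A s) => c.1) ⟨s, _, hmem⟩)
      (.func (L := (F.lang i).lang) ⟨f, hf⟩
        (fun k => .var (σ := fun c : (Σ s, A s) => c.1) ⟨_, v k⟩))).1 rfl
    refine h2.trans ?_
    change P'.funMap f (fun k => g _ (v k)) = P'.funMap f _
    exact congrArg _ (funext hgv)

/-- One step of the back-and-forth: an element of `M` has a counterpart in some elementary
extension of `N`. -/
theorem exists_extension_step [Nonempty I] (hexists : F.FusionExists)
    (hind : F.AdmitsStationaryExtendable) {M N : S → Type u} {P : Interp F.L M}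
    {P' : Interp F.L N} (hP' : P'.Models F.Tstar) {A : Sub M} (hA : ∀ i, acl (F.red P i) A = A)
    (hAcap : acl (F.redCap P) A = A) (g : ∀ s, A s → N s)
    (hg : ∀ i, SameType (F.red P i) (F.red P' i) (fun c : (Σ s, A s) => (c.2 : M c.1))
      (fun c => g c.1 c.2)) {s : S} (m : M s) :
    ∃ (N' : S → Type u) (P'' : Interp F.L N') (j : ∀ s, N s → N' s) (n : N' s), Elem P' P'' j ∧
      ∀ i, SameType (F.red P i) (F.red P'' i)
        (tupleSum (fun _ : Unit => m) (fun c : (Σ s, A s) => (c.2 : M c.1)))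
        (tupleSum (fun _ : Unit => n) (fun c => j _ (g c.1 c.2))) := by
  classical
  obtain ⟨i₀⟩ := id ‹Nonempty I›
  let σ : PUnit.{u + 1} ⊕ (Σ s, N s) → S := Sum.elim (fun _ => s) (fun c => c.1)
  let r : ∀ z, Term F.L σ (Sum.elim (fun _ : Unit => s) (fun c : (Σ s, A s) => c.1) z) := fun
    | .inl _ => .var (σ := σ) (.inl ⟨⟩)
    | .inr c => .var (σ := σ) (.inr ⟨c.1, g c.1 c.2⟩)
  let f : (Σ i, PFormula (F.lang i).lang (fun _ : Unit => s) A) → Formula F.L σ :=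
    fun Φ => (BForm.map (F.lang Φ.1).incl Φ.2).substFree r
  have hf : ∀ {N' : S → Type u} (P'' : Interp F.L N') (j : ∀ s, N s → N' s)
      (y : PUnit.{u + 1} → N' s) (Φ : Σ i, PFormula (F.lang i).lang (fun _ : Unit => s) A),
      P''.Realize (f Φ) (tupleSum (σ := fun _ => s) y (fun c => j c.1 c.2)) ↔
        (F.red P'' Φ.1).Realize Φ.2 (tupleSum (fun _ => y ⟨⟩) (fun c => j _ (g c.1 c.2))) := by
    intro N' P'' j y Φ
    refine (Interp.realize_substFree _ _ _ _).trans ((Interp.realize_map _ _ _ _).trans ?_)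
    apply iff_of_eq
    congr 1
    funext z
    cases z <;> rfl
  obtain ⟨N', P'', j, y, hj, hy⟩ := exists_elem_realize P' (J := PUnit.{u + 1})
    (x := fun _ => s) (f '' {Φ | (F.red P Φ.1).PRealize Φ.2 (fun _ => m)}) (by
      intro E hE
      obtain ⟨E', hE', rfl⟩ := Finset.subset_set_image_iff.1 hE
      let Ψ : ∀ i, Finset (PFormula (F.lang i).lang (fun _ : Unit => s) A) := fun i =>
        E'.preimage (Sigma.mk (β := fun i => PFormula (F.lang i).lang (fun _ : Unit => s) A) i)
          sigma_mk_injective.injOn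
      obtain ⟨n, hn⟩ := exists_common_realization hexists hind hP' hA hAcap g hg m
        (insert i₀ (E'.image Sigma.fst)) (by simp) (fun i => .conj (Ψ i).toList) (by
          intro i _
          rw [Interp.PRealize, Interp.realize_conj]
          intro Φ hΦ
          simp only [Ψ, Finset.mem_toList, Finset.mem_preimage] at hΦ
          exact hE' hΦ)
      refine ⟨fun _ => n, fun χ hχ => ?_⟩
      obtain ⟨⟨i, Φ⟩, hΦ, rfl⟩ := Finset.mem_image.1 hχ
      refine (hf P' (fun _ m => m) _ _).2 ?_
      have h1 := hn i (Finset.mem_insert_of_mem (Finset.mem_image.2 ⟨_, hΦ, rfl⟩))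
      rw [Interp.realize_conj] at h1
      exact h1 Φ (by simpa [Ψ] using hΦ))
  exact ⟨N', P'', j, y ⟨⟩, hj, fun i => SameType.of_imp fun Φ hΦ =>
    (hf P'' j y ⟨i, Φ⟩).1 (hy _ ⟨⟨i, Φ⟩, hΦ, rfl⟩)⟩

/-- The inductive form of `sameType_of_forall_sameType`, for formulas with bound variables. In the
step for a quantifier the target structure is replaced by an elementary extension, so that the
statement is proved for all pairs of models at once. -/
theorem sat_iff_of_sameType [Nonempty I] (hexists : F.FusionExists)
    (hind : F.AdmitsStationaryExtendable)
    (hacl : ∀ (M : S → Type u) (P : Interp F.L M), P.Models F.Tstar →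
      ∀ (A : Sub M) (i : I), acl (F.red P i) A = acl (F.redCap P) A ∧
        autOver (F.redCap P) (acl (F.redCap P) A) A = autOver (F.red P i) (acl (F.redCap P) A) A)
    {V : Type u} {σ : V → S} {Γ : List S} (φ : BForm F.L σ Γ) {M N : S → Type u}
    {P : Interp F.L M} {P' : Interp F.L N} (hP : P.Models F.Tstar) (hP' : P'.Models F.Tstar)
    (a : ∀ x, M (σ x)) (e : ∀ k : Fin Γ.length, M (Γ.get k)) (b : ∀ x, N (σ x))
    (e' : ∀ k : Fin Γ.length, N (Γ.get k))
    (h : ∀ i, SameType (F.red P i) (F.red P' i) (x := ctx σ Γ) (tupleSum a e)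
      (tupleSum b e')) :
    φ.Sat P a e ↔ φ.Sat P' b e' := by
  have key : ∀ {Γ : List S} {M N : S → Type u}
      {P : Interp F.L M} {P' : Interp F.L N}, P.Models F.Tstar → P'.Models F.Tstar →
      ∀ (a : ∀ x, M (σ x)) (e : ∀ k : Fin Γ.length, M (Γ.get k)) (b : ∀ x, N (σ x))
      (e' : ∀ k : Fin Γ.length, N (Γ.get k)),
      (∀ i, SameType (F.red P i) (F.red P' i) (x := ctx σ Γ) (tupleSum a e) (tupleSum b e')) →
      ∃ (A : Sub M) (g : ∀ s, A s → N s), (∀ i, acl (F.red P i) A = A) ∧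
        acl (F.redCap P) A = A ∧
        (∀ i, SameType (F.red P i) (F.red P' i) (fun c : (Σ s, A s) => (c.2 : M c.1))
          (fun c => g c.1 c.2)) ∧
        ∃ c : ∀ z, A (ctx σ Γ z), (tupleSum a e = fun z => (c z : M (ctx σ Γ z))) ∧
          tupleSum b e' = fun z => g _ (c z) := by
    intro Γ M N P P' hP hP' a e b e' h
    obtain ⟨A, g, h1, h2, h3, h4⟩ := exists_closed_extension hexists hind hacl hP hP' h
    choose h5 h6 using h4
    exact ⟨A, g, h1, h2, h3, fun z => ⟨_, h5 z⟩, rfl, funext fun z => (h6 z).symm⟩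
  induction φ generalizing M N with
  | falsum => exact Iff.rfl
  | @equal Γ s t t' =>
    obtain ⟨A, g, hA, -, hg, c, hc, hc'⟩ := key hP hP' a e b e' h
    obtain ⟨i⟩ := id ‹Nonempty I›
    change t.eval P (tupleSum a e) = t'.eval P (tupleSum a e) ↔
      t.eval P' (tupleSum b e') = t'.eval P' (tupleSum b e')
    obtain ⟨h1, h2⟩ := eval_mem_of_acl_eq hA hg c t
    obtain ⟨h1', h2'⟩ := eval_mem_of_acl_eq hA hg c t'
    rw [hc, hc']
    rw [show t.eval P' _ = _ from h2.symm, show t'.eval P' _ = _ from h2'.symm]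
    exact (hg i).eq_iff (s := s)
      (.var (σ := fun c : (Σ s, A s) => c.1) ⟨s, _, h1⟩)
      (.var (σ := fun c : (Σ s, A s) => c.1) ⟨s, _, h1'⟩)
  | @rel Γ d R ts =>
    obtain ⟨A, g, hA, -, hg, c, hc, hc'⟩ := key hP hP' a e b e' h
    obtain ⟨i, hR⟩ := F.rels_union d R
    choose h1 h2 using fun k => eval_mem_of_acl_eq hA hg c (ts k)
    have h3 := hg i (relForm (L := (F.lang i).lang) ⟨R, hR⟩ fun k =>
      .var (σ := fun c : (Σ s, A s) => c.1) ⟨_, _, h1 k⟩)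
    have h3 := (Interp.realize_relForm _ _ _ _).symm.trans
      (h3.trans (Interp.realize_relForm _ _ _ _))
    change P.relMap R _ ↔ P'.relMap R (fun k => g _ ⟨_, h1 k⟩) at h3
    rw [funext h2] at h3
    change P.relMap R (fun k => (ts k).eval P (tupleSum a e)) ↔
      P'.relMap R (fun k => (ts k).eval P' (tupleSum b e'))
    rw [hc, hc']
    exact h3
  | imp φ ψ ihφ ihψ => exact imp_congr (ihφ hP hP' a e b e' h) (ihψ hP hP' a e b e' h)
  | @all Γ s φ ih =>
    have half : ∀ {M N : S → Type u} {P : Interp F.L M} {P' : Interp F.L N},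
        P.Models F.Tstar → P'.Models F.Tstar →
        ∀ (a : ∀ x, M (σ x)) (e : ∀ k : Fin Γ.length, M (Γ.get k)) (b : ∀ x, N (σ x))
        (e' : ∀ k : Fin Γ.length, N (Γ.get k)),
        (∀ i, SameType (F.red P i) (F.red P' i) (x := ctx σ Γ) (tupleSum a e)
          (tupleSum b e')) →
        BForm.Sat P' b (.all s φ) e' → BForm.Sat P a (.all s φ) e := by
      intro M N P P' hP hP' a e b e' h hall m
      obtain ⟨A, g, hA, hAcap, hg, c, hc, hc'⟩ := key hP hP' a e b e' h
      obtain ⟨N', P'', j, n, hj, hn⟩ := exists_extension_step hexists hind hP' hA hAcap g hg m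
      let σ' : Unit ⊕ (Σ s, A s) → S := Sum.elim (fun _ => s) (fun c => c.1)
      have h1 : BForm.Sat P'' (fun x => j _ (b x)) (.all s φ) (fun k => j _ (e' k)) :=
        ((hj.sameType_tupleSum b e').sat_iff _).1 hall
      refine (ih hP (hj.models hP') a _ (fun x => j _ (b x))
        (Fin.cons (n := Γ.length) (α := fun k => N' ((s :: Γ).get k)) n (fun k => j _ (e' k)))
        fun i => ?_).2 (h1 n)
      have h2 := (hn i).subst (σ' := ctx σ (s :: Γ)) fun
        | .inl x => .var (σ := σ') (.inr ⟨_, c (.inl x)⟩)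
        | .inr k => Fin.cases (motive := fun k : Fin (Γ.length + 1) =>
            Term (F.lang i).lang σ' ((s :: Γ).get k)) (.var (σ := σ') (.inl ()))
            (fun k => .var (σ := σ') (.inr ⟨_, c (.inr k)⟩)) k
      refine fun χ => Iff.trans (iff_of_eq ?_) ((h2 χ).trans (iff_of_eq ?_))
      · congr 1
        funext z
        rcases z with x | k
        · exact congrFun hc (.inl x)
        · refine Fin.cases (motive := fun k : Fin (Γ.length + 1) => tupleSum a
            (Fin.cons (n := Γ.length) (α := fun k => M ((s :: Γ).get k)) m e) (.inr k) =
            Term.eval (F.red P i) _ (Fin.cases (motive := fun k : Fin (Γ.length + 1) =>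
            Term (F.lang i).lang σ' ((s :: Γ).get k)) (.var (σ := σ') (.inl ()))
            (fun k => .var (σ := σ') (.inr ⟨_, c (.inr k)⟩)) k)) rfl (fun k => ?_) k
          exact congrFun hc (.inr k)
      · congr 1
        funext z
        rcases z with x | k
        · exact congrArg (j _) (congrFun hc' (.inl x)).symm
        · refine Fin.cases (motive := fun k : Fin (Γ.length + 1) =>
            Term.eval (F.red P'' i) _ (Fin.cases (motive := fun k : Fin (Γ.length + 1) =>
            Term (F.lang i).lang σ' ((s :: Γ).get k)) (.var (σ := σ') (.inl ()))
            (fun k => .var (σ := σ') (.inr ⟨_, c (.inr k)⟩)) k) = tupleSum (fun x => j _ (b x))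
            (Fin.cons (n := Γ.length) (α := fun k => N' ((s :: Γ).get k)) n
              (fun k => j _ (e' k))) (.inr k)) rfl (fun k => ?_) k
          exact congrArg (j _) (congrFun hc' (.inr k)).symm
    exact ⟨half hP' hP b e' a e fun i => (h i).symm, half hP hP' a e b e' h⟩

/-- In models of `F.Tstar`, tuples with the same `lang i`-types for all `i` have the same type. -/
theorem sameType_of_forall_sameType [Nonempty I] (hexists : F.FusionExists)
    (hind : F.AdmitsStationaryExtendable)
    (hacl : ∀ (M : S → Type u) (P : Interp F.L M), P.Models F.Tstar →
      ∀ (A : Sub M) (i : I), acl (F.red P i) A = acl (F.redCap P) A ∧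
        autOver (F.redCap P) (acl (F.redCap P) A) A = autOver (F.red P i) (acl (F.redCap P) A) A)
    {V : Type u} {σ : V → S} {M N : S → Type u} {P : Interp F.L M} {P' : Interp F.L N}
    (hP : P.Models F.Tstar) (hP' : P'.Models F.Tstar) {a : ∀ x, M (σ x)} {b : ∀ x, N (σ x)}
    (h : ∀ i, SameType (F.red P i) (F.red P' i) a b) : SameType P P' a b := fun φ => by
  refine sat_iff_of_sameType hexists hind hacl φ hP hP' a _ b _ fun i => ?_
  have h1 := (h i).subst (σ' := ctx σ []) fun
    | .inl x => .var x
    | .inr k => k.elim0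
  refine fun χ => Iff.trans (iff_of_eq ?_) ((h1 χ).trans (iff_of_eq ?_)) <;>
  · congr 1
    funext z
    rcases z with x | k
    · rfl
    · exact k.elim0

end FusionFamily

/-! ### Boolean combinations -/

namespace FusionFamily

variable {S I : Type u} {F : FusionFamily S I}

theorem BoolComb.conj {V : Type v} {σ : V → S} {l : List (Formula F.L σ)}
    (h : ∀ φ ∈ l, F.BoolComb φ) : F.BoolComb (BForm.conj l) := by
  induction l with
  | nil => exact .imp .falsum .falsum
  | cons φ l ih =>
    exact .imp (.imp (h φ (by simp)) (.imp (ih fun ψ hψ => h ψ (by simp [hψ])) .falsum)) .falsum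

theorem BoolComb.rename {V : Type v} {V' : Type w} (f : V → V') {σ : V' → S}
    {θ : Formula F.L (fun x => σ (f x))} (h : F.BoolComb θ) :
    ∃ θ' : Formula F.L σ, F.BoolComb θ' ∧ ∀ (M : S → Type u) (P : Interp F.L M)
      (a : ∀ y, M (σ y)), P.Realize θ' a ↔ P.Realize θ (fun x => a (f x)) := by
  induction h with
  | of i φ =>
    refine ⟨_, .of i (φ.substFree fun x => .var (σ := σ) (f x)), fun M P a => ?_⟩
    rw [Interp.realize_map, Interp.realize_substFree, Interp.realize_map]
    rfl
  | falsum => exact ⟨_, .falsum, fun M P a => Iff.rfl⟩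
  | imp _ _ ih ih' =>
    obtain ⟨θ, h, hθ⟩ := ih
    obtain ⟨θ', h', hθ'⟩ := ih'
    exact ⟨_, .imp h h', fun M P a => imp_congr (hθ M P a) (hθ' M P a)⟩

/-- A formula whose truth in models of `F.Tstar` only depends on `lang i`-types is equivalent to
a Boolean combination of `lang i`-formulas, by compactness. -/
theorem exists_boolComb {V : Type u} {σ : V → S} (ψ : Formula F.L σ)
    (hsep : ∀ (M N : S → Type u) (P : Interp F.L M) (P' : Interp F.L N), P.Models F.Tstar →
      P'.Models F.Tstar → ∀ (a : ∀ x, M (σ x)) (b : ∀ x, N (σ x)),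
      (∀ i, SameType (F.red P i) (F.red P' i) a b) → P.Realize ψ a → P'.Realize ψ b) :
    ∃ θ : Formula F.L σ, F.BoolComb θ ∧ ∀ (M : S → Type u) (P : Interp F.L M),
      P.Models F.Tstar → ∀ a : ∀ x, M (σ x), P.Realize ψ a ↔ P.Realize θ a := by
  classical
  let D : Set (Formula F.L σ) := {θ | F.BoolComb θ ∧ ∀ (M : S → Type u) (P : Interp F.L M),
    P.Models F.Tstar → ∀ a : ∀ x, M (σ x), P.Realize ψ a → P.Realize θ a}
  have hD : ∀ (N : S → Type u) (P' : Interp F.L N), P'.Models F.Tstar → ∀ b : ∀ x, N (σ x),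
      (∀ θ ∈ D, P'.Realize θ b) → P'.Realize ψ b := by
    intro N P' hP' b hb
    obtain ⟨M, P, a, hP, ha⟩ := compactness F.Tstar
      ({θ | F.BoolComb θ ∧ P'.Realize θ b} ∪ {ψ}) (by
        intro E hE
        by_contra hc
        push Not at hc
        let E' := E.filter fun θ => F.BoolComb θ ∧ P'.Realize θ b
        have h1 : BForm.neg (BForm.conj E'.toList) ∈ D := by
          refine ⟨.imp (BoolComb.conj fun φ hφ => ?_) .falsum, fun M P hP a ha h2 => ?_⟩
          · simp only [E', Finset.mem_toList, Finset.mem_filter] at hφ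
            exact hφ.2.1
          · obtain ⟨φ, hφ, hn⟩ := hc M P a hP
            refine hn ?_
            rcases hE hφ with h3 | rfl
            · exact (Interp.realize_conj P a _).1 h2 φ (by simpa [E'] using ⟨hφ, h3⟩)
            · exact ha
        refine hb _ h1 ((Interp.realize_conj _ _ _).2 fun φ hφ => ?_)
        simp only [E', Finset.mem_toList, Finset.mem_filter] at hφ
        exact hφ.2.2)
    refine hsep M N P P' hP hP' a b (fun i => (SameType.of_imp fun φ hφ => ?_).symm)
      (ha ψ (.inr rfl))
    rw [red, ← Interp.realize_map] at hφ ⊢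
    exact ha _ (.inl ⟨.of i φ, hφ⟩)
  have h4 : ∃ E : Finset (Formula F.L σ), (E : Set _) ⊆ D ∪ {ψ.neg} ∧
      ¬ ∃ (M : S → Type u) (P : Interp F.L M) (a : ∀ x, M (σ x)), P.Models F.Tstar ∧
        ∀ φ ∈ E, P.Realize φ a := by
    by_contra hc
    push Not at hc
    obtain ⟨M, P, a, hP, ha⟩ := compactness F.Tstar (D ∪ {ψ.neg}) hc
    exact ha ψ.neg (.inr rfl) (hD M P hP a fun θ hθ => ha θ (.inl hθ))
  obtain ⟨E, hE, hn⟩ := h4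
  refine ⟨BForm.conj (E.filter (· ∈ D)).toList, BoolComb.conj fun φ hφ => ?_,
    fun M P hP a => ⟨fun h => ?_, fun h => ?_⟩⟩
  · simp only [Finset.mem_toList, Finset.mem_filter] at hφ
    exact hφ.2.1
  · rw [Interp.realize_conj]
    intro φ hφ
    simp only [Finset.mem_toList, Finset.mem_filter] at hφ
    exact hφ.2.2 M P hP a h
  · rw [Interp.realize_conj] at h
    by_contra hψ
    refine hn ⟨M, P, a, hP, fun φ hφ => ?_⟩
    rcases hE hφ with h5 | rfl
    · exact h φ (by simpa using ⟨hφ, h5⟩)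
    · exact hψ

end FusionFamily

/-! ### The order property and the independence property of implications -/

section Combinatorics

open Filter

/-- Ramsey's theorem for pairs: on an infinite set of indices, the truth value of a relation
only depends on the order of the two indices. -/
theorem exists_strictMono_homogeneous (R : ℕ → ℕ → Prop) :
    ∃ h : ℕ → ℕ, StrictMono h ∧ ∃ t f : Prop, ∀ k l, k < l →
      (R (h k) (h l) ↔ t) ∧ (R (h l) (h k) ↔ f) := by
  let U : Ultrafilter ℕ := hyperfilter ℕ
  have aux : ∀ R : ℕ → ℕ → Prop, ∃ t : Prop,
      ∀ᶠ k in (U : Filter ℕ), ∀ᶠ l in (U : Filter ℕ), (R k l ↔ t) := by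
    intro R
    by_cases h : ∀ᶠ k in (U : Filter ℕ), ∀ᶠ l in (U : Filter ℕ), R k l
    · exact ⟨True, by simpa using h⟩
    · refine ⟨False, ?_⟩
      rw [← Ultrafilter.eventually_not] at h
      refine h.mono fun k hk => ?_
      rw [← Ultrafilter.eventually_not] at hk
      simpa using hk
  obtain ⟨t, ht⟩ := aux R
  obtain ⟨f, hf⟩ := aux fun k l => R l k
  obtain ⟨h, -, hh⟩ := exists_seq_of_forall_finset_exists
    (fun k => ∀ᶠ l in (U : Filter ℕ), (R k l ↔ t) ∧ (R l k ↔ f))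
    (fun k l => k < l ∧ (R k l ↔ t) ∧ (R l k ↔ f)) (by
      intro s hs
      have h1 : ∀ᶠ l in (U : Filter ℕ), ∀ k ∈ s, k < l ∧ (R k l ↔ t) ∧ (R l k ↔ f) := by
        rw [eventually_all_finset]
        intro k hk
        have h2 : ∀ᶠ l in (U : Filter ℕ), k < l := by
          refine (Nat.hyperfilter_le_atTop) (eventually_gt_atTop k)
        exact h2.and (hs k hk)
      obtain ⟨y, h3, h4, h5⟩ := (h1.and (ht.and hf)).exists
      exact ⟨y, h4.and h5, h3⟩)
  exact ⟨h, strictMono_nat_of_lt_succ fun k => (hh k _ k.lt_succ_self).1, t, f,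
    fun k l hkl => (hh k l hkl).2⟩

/-- The relation `R`, or its complement, has the order property. -/
def OrderLike {X Y : Type*} (R : X → Y → Prop) : Prop :=
  ∃ (a : ℕ → X) (b : ℕ → Y), (∀ k l, R (a k) (b l) ↔ k < l) ∨ (∀ k l, R (a k) (b l) ↔ ¬ k < l)

theorem OrderLike.of_imp {X Y : Type*} {R R' : X → Y → Prop}
    (h : OrderLike fun x y => R x y → R' x y) : OrderLike R ∨ OrderLike R' := by
  obtain ⟨a, b, h⟩ := h
  obtain ⟨h₁, hm₁, t, f, htf⟩ := exists_strictMono_homogeneous fun k l => R (a k) (b l)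
  obtain ⟨h₂, hm₂, t', f', htf'⟩ :=
    exists_strictMono_homogeneous fun k l => R' (a (h₁ k)) (b (h₁ l))
  -- odd and even indices, so that no index is used for both `a` and `b`
  let u : ℕ → X := fun k => a (h₁ (h₂ (2 * k + 1)))
  let v : ℕ → Y := fun l => b (h₁ (h₂ (2 * l)))
  have hu : ∀ k l, (k < l → (R (u k) (v l) ↔ t) ∧ (R' (u k) (v l) ↔ t')) ∧
      (¬ k < l → (R (u k) (v l) ↔ f) ∧ (R' (u k) (v l) ↔ f')) := by
    intro k l
    constructor
    · intro hkl
      have h3 : 2 * k + 1 < 2 * l := by omega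
      exact ⟨(htf _ _ (hm₂ h3)).1, (htf' _ _ h3).1⟩
    · intro hkl
      have h3 : 2 * l < 2 * k + 1 := by omega
      exact ⟨(htf _ _ (hm₂ h3)).2, (htf' _ _ h3).2⟩
  have key : ∀ (R : X → Y → Prop) (t f : Prop), (∀ k l, (k < l → (R (u k) (v l) ↔ t)) ∧
      (¬ k < l → (R (u k) (v l) ↔ f))) → ¬ (t ↔ f) → OrderLike R := by
    intro R t f h3 h4
    refine ⟨u, v, ?_⟩
    by_cases ht : t
    · have hf : ¬ f := by tauto
      refine .inl fun k l => ?_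
      by_cases hkl : k < l
      · simp [hkl, (h3 k l).1 hkl, ht]
      · simp [hkl, (h3 k l).2 hkl, hf]
    · have hf : f := by tauto
      refine .inr fun k l => ?_
      by_cases hkl : k < l
      · simp [hkl, (h3 k l).1 hkl, ht]
      · simp [hkl, (h3 k l).2 hkl, hf]
  have h5 : ¬ ((t → t') ↔ (f → f')) := by
    have e1 := (hu 0 1).1 (by norm_num)
    have e2 := (hu 0 0).2 (by norm_num)
    have hlt : ∀ k l, h₁ (h₂ k) < h₁ (h₂ l) ↔ k < l := fun k l => (hm₁.comp hm₂).lt_iff_lt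
    rw [← e1.1, ← e1.2, ← e2.1, ← e2.2]
    rcases h with h | h
    · have h6 := h (h₁ (h₂ (2 * 0 + 1))) (h₁ (h₂ (2 * 1)))
      have h7 := h (h₁ (h₂ (2 * 0 + 1))) (h₁ (h₂ (2 * 0)))
      rw [hlt] at h6 h7
      exact fun e => absurd (h7.1 (e.1 (h6.2 (by norm_num)))) (by norm_num)
    · have h6 := h (h₁ (h₂ (2 * 0 + 1))) (h₁ (h₂ (2 * 1)))
      have h7 := h (h₁ (h₂ (2 * 0 + 1))) (h₁ (h₂ (2 * 0)))
      rw [hlt] at h6 h7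
      exact fun e => h6.1 (e.2 (h7.2 (by norm_num))) (by norm_num)
  by_cases h6 : t ↔ f
  · refine .inr (key R' t' f' (fun k l => ⟨fun h => ((hu k l).1 h).2, fun h => ((hu k l).2 h).2⟩)
      fun h7 => h5 (by rw [h6, h7]))
  · exact .inl (key R t f (fun k l => ⟨fun h => ((hu k l).1 h).1, fun h => ((hu k l).2 h).1⟩) h6)

/-- The relation `R` shatters finite sets of arbitrary size. -/
def ShattersFinite {X Y : Type*} (R : X → Y → Prop) : Prop :=
  ∀ n : ℕ, ∃ (a : Fin n → X) (b : Finset (Fin n) → Y), ∀ k s, R (a k) (b s) ↔ k ∈ s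

open Classical in
/-- By the Sauer–Shelah lemma, a relation which does not shatter large sets cuts out few subsets
of any finite set. -/
theorem card_traces_le {X Y : Type*} {R : X → Y → Prop} {n : ℕ}
    (hn : ¬ ∃ (a : Fin n → X) (b : Finset (Fin n) → Y), ∀ k s, R (a k) (b s) ↔ k ∈ s)
    {N : ℕ} (a : Fin N → X) (b : Finset (Fin N) → Y) :
    (Finset.univ.image fun s => Finset.univ.filter fun k => R (a k) (b s)).card ≤
      (n + 1) * (N + 1) ^ n := by
  set 𝒜 := Finset.univ.image fun s => Finset.univ.filter fun k => R (a k) (b s) with h𝒜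
  have h1 : ∀ s, 𝒜.Shatters s → s.card < n := by
    intro s hs
    by_contra hsn
    push Not at hsn
    obtain ⟨s', hs', hcard⟩ := Finset.exists_subset_card_eq hsn
    replace hs := hs.mono_right hs'
    let e : Fin n ≃ s' := (Fintype.equivFinOfCardEq (by simpa using hcard)).symm
    have h2 : ∀ t : Finset (Fin n), ∃ q, s' ∩ (Finset.univ.filter fun k => R (a k) (b q)) =
        t.image fun k => (e k : Fin N) := by
      intro t
      obtain ⟨u, hu, h3⟩ := hs (t := t.image fun k => (e k : Fin N)) (by
        intro x hx
        obtain ⟨k, -, rfl⟩ := Finset.mem_image.1 hx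
        exact (e k).2)
      obtain ⟨q, -, rfl⟩ := Finset.mem_image.1 hu
      exact ⟨q, h3⟩
    choose q hq using h2
    refine hn ⟨fun k => a (e k), fun t => b (q t), fun k t => ?_⟩
    have h3 := Finset.ext_iff.1 (hq t) (e k)
    simp only [Finset.mem_inter, (e k).2, Finset.mem_filter, Finset.mem_univ, true_and,
      Finset.mem_image] at h3
    rw [h3]
    constructor
    · rintro ⟨l, hl, hlk⟩
      rwa [← e.injective (Subtype.ext hlk)]
    · exact fun hk => ⟨k, hk, rfl⟩
  have h2 : 𝒜.vcDim ≤ n := Finset.sup_le fun s hs => (h1 s (Finset.mem_shatterer.1 hs)).le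
  calc 𝒜.card ≤ 𝒜.shatterer.card := 𝒜.card_le_card_shatterer
    _ ≤ ∑ k ∈ Finset.Iic 𝒜.vcDim, (Fintype.card (Fin N)).choose k :=
      Finset.card_shatterer_le_sum_vcDim
    _ ≤ ∑ k ∈ Finset.Iic n, (N + 1) ^ n := by
      refine (Finset.sum_le_sum_of_subset (Finset.Iic_subset_Iic.2 h2)).trans
        (Finset.sum_le_sum fun k hk => ?_)
      rw [Fintype.card_fin]
      exact (Nat.choose_le_pow N k).trans ((Nat.pow_le_pow_left N.le_succ k).trans
        (Nat.pow_le_pow_right N.succ_pos (Finset.mem_Iic.1 hk)))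
    _ = (n + 1) * (N + 1) ^ n := by simp

theorem exists_mul_pow_lt_two_pow (C D : ℕ) : ∃ N : ℕ, C * (N + 1) ^ D < 2 ^ N := by
  have h := tendsto_pow_const_div_const_pow_of_one_lt D (r := (2 : ℝ)) (by norm_num)
  have h1 := (h.comp (tendsto_add_atTop_nat 1)).eventually
    (gt_mem_nhds (show (0 : ℝ) < 1 / (2 * (C + 1)) by positivity))
  obtain ⟨N, hN⟩ := h1.exists
  refine ⟨N, ?_⟩
  simp only [Function.comp] at hN
  rw [div_lt_div_iff₀ (by positivity) (by positivity)] at hN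
  have h2 : ((C * (N + 1) ^ D : ℕ) : ℝ) < ((2 ^ N : ℕ) : ℝ) := by
    push_cast at hN ⊢
    have : (0 : ℝ) ≤ ((N : ℝ) + 1) ^ D := by positivity
    rw [pow_succ] at hN
    nlinarith
  exact_mod_cast h2

theorem ShattersFinite.of_imp {X Y : Type*} {R R' : X → Y → Prop}
    (h : ShattersFinite fun x y => R x y → R' x y) : ShattersFinite R ∨ ShattersFinite R' := by
  classical
  by_contra hc
  simp only [not_or, ShattersFinite, not_forall] at hc
  obtain ⟨⟨n, hn⟩, n', hn'⟩ := hc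
  obtain ⟨N, hN⟩ := exists_mul_pow_lt_two_pow ((n + 1) * (n' + 1)) (n + n')
  obtain ⟨a, b, hab⟩ := h N
  have h1 := card_traces_le hn a b
  have h2 := card_traces_le hn' a b
  -- the trace of the implication is determined by the two traces
  have h3 : Function.Injective fun s : Finset (Fin N) =>
      (Finset.univ.filter fun k => R (a k) (b s), Finset.univ.filter fun k => R' (a k) (b s)) := by
    intro s s' hs
    simp only [Prod.mk.injEq, Finset.ext_iff, Finset.mem_filter, Finset.mem_univ,
      true_and] at hs
    ext k
    rw [← hab k s, ← hab k s']
    exact imp_congr (hs.1 k) (hs.2 k)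
  have h4 := Finset.card_image_of_injective Finset.univ h3
  have h5 := Finset.card_le_card (show Finset.univ.image (fun s : Finset (Fin N) =>
      (Finset.univ.filter fun k => R (a k) (b s), Finset.univ.filter fun k => R' (a k) (b s))) ⊆
      (Finset.univ.image fun s => Finset.univ.filter fun k => R (a k) (b s)) ×ˢ
        (Finset.univ.image fun s => Finset.univ.filter fun k => R' (a k) (b s)) by
    intro z hz
    obtain ⟨s, -, rfl⟩ := Finset.mem_image.1 hz
    exact Finset.mk_mem_product (Finset.mem_image_of_mem _ (Finset.mem_univ s))
      (Finset.mem_image_of_mem _ (Finset.mem_univ s)))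
  rw [h4, Finset.card_product, Finset.card_univ, Fintype.card_finset, Fintype.card_fin] at h5
  have h6 := h5.trans (Nat.mul_le_mul h1 h2)
  rw [show (n + 1) * (N + 1) ^ n * ((n' + 1) * (N + 1) ^ n') =
    (n + 1) * (n' + 1) * (N + 1) ^ (n + n') by ring] at h6
  omega

end Combinatorics

/-! ### Stable theories, NIP theories, and complete types -/

section Theories

variable {S : Type u} {L : Language.{u} S}

theorem Theory.Stable.not_orderLike {T : Theory L} (hT : T.Stable) {M : S → Type u}
    {K : Interp L M} (hK : K.Models T) {m n : ℕ} {x : Fin m → S} {y : Fin n → S}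
    (φ : Formula L (Sum.elim x y)) :
    ¬ OrderLike fun (a : ∀ j, M (x j)) (b : ∀ j, M (y j)) => K.Realize φ (tupleSum a b) := by
  rintro ⟨a, b, h | h⟩
  · exact hT M K hK m n x y φ ⟨a, b, h⟩
  · exact hT M K hK m n x y φ.neg ⟨a, b, fun k l => (not_congr (h k l)).trans not_not⟩

/-- By compactness, the independence property can be detected on finite sets. -/
theorem Theory.NIP.not_shattersFinite {T : Theory L} (hT : T.NIP) {M : S → Type u}
    {K : Interp L M} (hK : K.Models T) {m n : ℕ} {x : Fin m → S} {y : Fin n → S}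
    (φ : Formula L (Sum.elim x y)) :
    ¬ ShattersFinite fun (a : ∀ j, M (x j)) (b : ∀ j, M (y j)) =>
      K.Realize φ (tupleSum a b) := by
  classical
  intro h
  let V : Type u := ULift.{u} ((ℕ × Fin m) ⊕ (Set ℕ × Fin n))
  let σ : V → S := fun z => Sum.elim (fun p => x p.2) (fun p => y p.2) z.down
  let τ : ∀ (q : ℕ × Set ℕ) z, Term L σ (Sum.elim x y z) := fun q => fun
    | .inl j => .var (σ := σ) ⟨.inl (q.1, j)⟩
    | .inr j => .var (σ := σ) ⟨.inr (q.2, j)⟩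
  let f : ℕ × Set ℕ → Formula L σ := fun q =>
    if q.1 ∈ q.2 then φ.substFree (τ q) else .neg (φ.substFree (τ q))
  have hf : ∀ {N : S → Type u} (K' : Interp L N) (c : ∀ z, N (σ z)) (q : ℕ × Set ℕ),
      K'.Realize (f q) c ↔ (K'.Realize φ (tupleSum (fun j => c ⟨.inl (q.1, j)⟩)
        (fun j => c ⟨.inr (q.2, j)⟩)) ↔ q.1 ∈ q.2) := by
    intro N K' c q
    have h1 : K'.Realize (φ.substFree (τ q)) c ↔ K'.Realize φ
        (tupleSum (fun j => c ⟨.inl (q.1, j)⟩) (fun j => c ⟨.inr (q.2, j)⟩)) := by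
      rw [Interp.realize_substFree]
      apply iff_of_eq
      congr 1
      funext z
      cases z <;> rfl
    by_cases hq : q.1 ∈ q.2
    · simp only [f, hq, if_true, iff_true]
      exact h1
    · simp only [f, hq, if_false, iff_false]
      exact not_congr h1
  obtain ⟨N, K', c, hK', hc⟩ := compactness T (Set.range f) (by
    intro E hE
    rw [← Set.image_univ] at hE
    obtain ⟨E', -, rfl⟩ := Finset.subset_set_image_iff.1 hE
    -- the indices in `E'` are at most `B`
    obtain ⟨B, hB⟩ := (E'.image Prod.fst).exists_nat_subset_range
    obtain ⟨a, b, hab⟩ := h (B + 1)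
    let c : ∀ z, M (σ z) := fun
      | ⟨.inl (k, j)⟩ => a (Fin.ofNat (B + 1) k) j
      | ⟨.inr (X, j)⟩ => b (Finset.univ.filter fun k => (k : ℕ) ∈ X) j
    refine ⟨M, K, c, hK, fun χ hχ => ?_⟩
    obtain ⟨q, hq, rfl⟩ := Finset.mem_image.1 hχ
    rw [hf]
    have h2 : q.1 < B := Finset.mem_range.1 (hB (Finset.mem_image_of_mem _ hq))
    refine (hab (Fin.ofNat (B + 1) q.1) _).trans ?_
    simp only [Finset.mem_filter, Finset.mem_univ, true_and, Fin.val_ofNat]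
    rw [Nat.mod_eq_of_lt (by omega)])
  exact hT N K' hK' m n x y φ ⟨fun k j => c ⟨.inl (k, j)⟩, fun X j => c ⟨.inr (X, j)⟩,
    fun k X => (hf K' c (k, X)).1 (hc _ ⟨_, rfl⟩)⟩

/-- Complete types are closed under equivalence of formulas. -/
theorem TypeSpace.mem_of_forall {M : S → Type w} {K : Interp L M} {A : Sub M} {J : Type v}
    {x : J → S} {p : Set (PFormula L x A)} (hp : p ∈ TypeSpace K A x) (l : List (PFormula L x A))
    (hl : ∀ φ ∈ l, φ ∈ p) (ψ : PFormula L x A)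
    (h : ∀ a, (∀ φ ∈ l, K.PRealize φ a) → K.PRealize ψ a) : ψ ∈ p := by
  classical
  refine (hp.1 ψ).resolve_right fun hn => ?_
  obtain ⟨a, ha⟩ := hp.2 (insert ψ.neg l.toFinset) (by
    intro φ hφ
    simp only [Finset.coe_insert, List.coe_toFinset, Set.mem_insert_iff, Set.mem_ofPred_eq] at hφ
    rcases hφ with rfl | hφ
    · exact hn
    · exact hl φ hφ)
  refine ha ψ.neg (Finset.mem_insert_self _ _) (h a fun φ hφ => ha φ ?_)
  exact Finset.mem_insert_of_mem (List.mem_toFinset.2 hφ)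

theorem TypeSpace.imp_mem_iff {M : S → Type w} {K : Interp L M} {A : Sub M} {J : Type v}
    {x : J → S} {p : Set (PFormula L x A)} (hp : p ∈ TypeSpace K A x) (φ ψ : PFormula L x A) :
    BForm.imp φ ψ ∈ p ↔ (φ ∈ p → ψ ∈ p) := by
  constructor
  · intro h hφ
    refine mem_of_forall hp [φ.imp ψ, φ] (by simp [h, hφ]) ψ fun a ha => ?_
    exact ha (φ.imp ψ) (by simp) (ha φ (by simp))
  · intro h
    by_cases hφ : φ ∈ p
    · exact mem_of_forall hp [ψ] (by simp [h hφ]) _ fun a ha _ => ha ψ (by simp)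
    · exact mem_of_forall hp [φ.neg] (by simpa using (hp.1 φ).resolve_left hφ) _
        fun a ha h1 => absurd h1 (ha φ.neg (by simp))

theorem TypeSpace.falsum_notMem {M : S → Type w} {K : Interp L M} {A : Sub M} {J : Type v}
    {x : J → S} {p : Set (PFormula L x A)} (hp : p ∈ TypeSpace K A x) :
    (BForm.falsum : PFormula L x A) ∉ p := fun h => by
  obtain ⟨a, ha⟩ := hp.2 {.falsum} (by simpa using h)
  exact ha .falsum (by simp)

end Theories

/-! ### Preservation of stability, NIP, and the number of types -/

namespace FusionFamily

variable {S I : Type u} {F : FusionFamily S I}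

theorem BoolComb.not_orderLike (hT : ∀ i, (F.T i).Stable) {M : S → Type u} {P : Interp F.L M}
    (hP : P.Models F.Tcup) {m n : ℕ} {x : Fin m → S} {y : Fin n → S}
    {θ : Formula F.L (Sum.elim x y)} (h : F.BoolComb θ) :
    ¬ OrderLike fun (a : ∀ j, M (x j)) (b : ∀ j, M (y j)) => P.Realize θ (tupleSum a b) := by
  induction h with
  | of i φ =>
    simp only [Interp.realize_map]
    exact (hT i).not_orderLike (models_red hP i) φ
  | falsum =>
    rintro ⟨a, b, h | h⟩
    · exact (h 0 1).2 one_pos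
    · exact (h 0 0).2 (lt_irrefl 0)
  | imp _ _ ih ih' => exact fun h => h.of_imp.elim ih ih'

theorem BoolComb.not_shattersFinite (hT : ∀ i, (F.T i).NIP) {M : S → Type u}
    {P : Interp F.L M} (hP : P.Models F.Tcup) {m n : ℕ} {x : Fin m → S} {y : Fin n → S}
    {θ : Formula F.L (Sum.elim x y)} (h : F.BoolComb θ) :
    ¬ ShattersFinite fun (a : ∀ j, M (x j)) (b : ∀ j, M (y j)) =>
      P.Realize θ (tupleSum a b) := by
  induction h with
  | of i φ =>
    simp only [Interp.realize_map]
    exact (hT i).not_shattersFinite (models_red hP i) φ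
  | falsum =>
    intro h
    obtain ⟨a, b, h⟩ := h 1
    exact (h 0 {0}).2 (by simp)
  | imp _ _ ih ih' => exact fun h => h.of_imp.elim ih ih'

/-- The restriction of a complete type to formulas in the language with index `i`. -/
def restrictType {M : S → Type u} (P : Interp F.L M) (A : Sub M) {J : Type v} (x : J → S)
    (p : TypeSpace P A x) (i : I) : TypeSpace (F.red P i) A x :=
  ⟨{φ | φ.map (F.lang i).incl ∈ p.1}, fun φ => p.2.1 _, fun E hE => by
    classical
    obtain ⟨a, ha⟩ := p.2.2 (E.image fun φ => φ.map (F.lang i).incl) (by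
      intro χ hχ
      simp only [Finset.coe_image, Set.mem_image] at hχ
      obtain ⟨φ, hφ, rfl⟩ := hχ
      exact hE hφ)
    exact ⟨a, fun φ hφ => (Interp.realize_map _ _ _ _).1 (ha _ (Finset.mem_image_of_mem _ hφ))⟩⟩

/-- If formulas are equivalent to Boolean combinations of `lang i`-formulas, then complete types
are determined by their restrictions to the languages with index `i`. -/
theorem restrictType_injective {M : S → Type u} {P : Interp F.L M} {A : Sub M} {J : Type v}
    {x : J → S} (h : ∀ ψ : PFormula F.L x A, ∃ θ : PFormula F.L x A, F.BoolComb θ ∧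
      ∀ a, P.PRealize ψ a ↔ P.PRealize θ a) :
    Function.Injective (F.restrictType P A x) := by
  intro p q hpq
  have h1 : ∀ i (φ : PFormula (F.lang i).lang x A),
      φ.map (F.lang i).incl ∈ p.1 ↔ φ.map (F.lang i).incl ∈ q.1 := fun i φ =>
    Set.ext_iff.1 (congrArg Subtype.val (congrFun hpq i)) φ
  have h2 : ∀ θ : PFormula F.L x A, F.BoolComb θ → (θ ∈ p.1 ↔ θ ∈ q.1) := by
    intro θ hθ
    induction hθ with
    | of i φ => exact h1 i φ
    | falsum => exact iff_of_false (TypeSpace.falsum_notMem p.2) (TypeSpace.falsum_notMem q.2)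
    | imp _ _ ih ih' =>
      rw [TypeSpace.imp_mem_iff p.2, TypeSpace.imp_mem_iff q.2, ih, ih']
  have h3 : ∀ (p : TypeSpace P A x) (ψ θ : PFormula F.L x A),
      (∀ a, P.PRealize ψ a ↔ P.PRealize θ a) → (ψ ∈ p.1 ↔ θ ∈ p.1) := fun p ψ θ e =>
    ⟨fun hψ => TypeSpace.mem_of_forall p.2 [ψ] (by simpa using hψ) θ
      fun a ha => (e a).1 (ha ψ (by simp)),
    fun hθ => TypeSpace.mem_of_forall p.2 [θ] (by simpa using hθ) ψ
      fun a ha => (e a).2 (ha θ (by simp))⟩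
  refine Subtype.ext (Set.ext fun ψ => ?_)
  obtain ⟨θ, hθ, e⟩ := h ψ
  rw [h3 p ψ θ e, h2 θ hθ, h3 q ψ θ e]

theorem mk_typeSpace_le {M : S → Type u} {P : Interp F.L M} {A : Sub M} {n : ℕ}
    {x : Fin n → S} (h : ∀ ψ : PFormula F.L x A, ∃ θ : PFormula F.L x A, F.BoolComb θ ∧
      ∀ a, P.PRealize ψ a ↔ P.PRealize θ a) {κ : Cardinal.{u}} (hκ : κ ^ Cardinal.mk I = κ)
    (hle : ∀ i, Cardinal.mk (TypeSpace (F.red P i) A x) ≤ κ) :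
    Cardinal.mk (TypeSpace P A x) ≤ κ :=
  calc Cardinal.mk (TypeSpace P A x)
      ≤ Cardinal.mk (∀ i, TypeSpace (F.red P i) A x) :=
        Cardinal.mk_le_of_injective (restrictType_injective h)
    _ = Cardinal.prod fun i => Cardinal.mk (TypeSpace (F.red P i) A x) := Cardinal.mk_pi _
    _ ≤ Cardinal.prod fun _ : I => κ := Cardinal.prod_le_prod _ _ hle
    _ = κ := by rw [Cardinal.prod_const', hκ]

end FusionFamily

end ManySorted

theorem mainTheorem7 {S I : Type u} [Nonempty I] (F : ManySorted.FusionFamily S I)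
    (hexists : F.FusionExists)
    (hind : F.AdmitsStationaryExtendable)
    (hacl : ∀ (M : S → Type u) (P : ManySorted.Interp F.L M), P.Models F.Tstar →
      ∀ (A : ManySorted.Sub M) (i : I),
        ManySorted.acl (F.red P i) A = ManySorted.acl (F.redCap P) A ∧
        ManySorted.autOver (F.redCap P) (ManySorted.acl (F.redCap P) A) A =
          ManySorted.autOver (F.red P i) (ManySorted.acl (F.redCap P) A) A) :
    (∀ (n : ℕ) (x : Fin n → S) (ψ : ManySorted.Formula F.L x),
      ∃ θ : ManySorted.Formula F.L x, F.BoolComb θ ∧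
        ∀ (M : S → Type u) (P : ManySorted.Interp F.L M), P.Models F.Tstar →
          ∀ a : ∀ j, M (x j), P.Realize ψ a ↔ P.Realize θ a) ∧
    ((∀ i, (F.T i).Stable) → F.Tstar.Stable) ∧
    ((∀ i, (F.T i).NIP) → F.Tstar.NIP) ∧
    (∀ κ : Cardinal.{u}, Cardinal.aleph0 ≤ κ → κ ^ Cardinal.mk I = κ →
      (∀ i, (F.T i).StableIn κ) → F.Tstar.StableIn κ) := by
  have large : ∀ {V : Type u} {σ : V → S} (ψ : ManySorted.Formula F.L σ),
      ∃ θ : ManySorted.Formula F.L σ, F.BoolComb θ ∧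
        ∀ (M : S → Type u) (P : ManySorted.Interp F.L M), P.Models F.Tstar →
          ∀ a : ∀ j, M (σ j), P.Realize ψ a ↔ P.Realize θ a := fun ψ =>
    ManySorted.FusionFamily.exists_boolComb ψ fun M N P P' hP hP' a b h =>
      (ManySorted.FusionFamily.sameType_of_forall_sameType hexists hind hacl hP hP' h ψ).1
  have small : ∀ {V : Type} {σ : V → S} (ψ : ManySorted.Formula F.L σ),
      ∃ θ : ManySorted.Formula F.L σ, F.BoolComb θ ∧
        ∀ (M : S → Type u) (P : ManySorted.Interp F.L M), P.Models F.Tstar →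
          ∀ a : ∀ j, M (σ j), P.Realize ψ a ↔ P.Realize θ a := by
    intro V σ ψ
    obtain ⟨θ, hθ, h⟩ := large (V := ULift.{u} V) (σ := fun z => σ z.down)
      (ψ.substFree fun z => .var (σ := fun z : ULift.{u} V => σ z.down) ⟨z⟩)
    obtain ⟨θ', hθ', h'⟩ := hθ.rename (ULift.down : ULift.{u} V → V) (σ := σ)
    refine ⟨θ', hθ', fun M P hP a => ?_⟩
    rw [h' M P a, ← h M P hP, ManySorted.Interp.realize_substFree]
    rfl
  have hcup : ∀ {M : S → Type u} {P : ManySorted.Interp F.L M}, P.Models F.Tstar →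
      P.Models F.Tcup := fun hP =>
    (ManySorted.FusionFamily.models_and_interpolative_of_models_Tstar hexists hP).1
  refine ⟨fun n x ψ => small ψ, fun hT M P hP m n x y φ => ?_, fun hT M P hP m n x y φ => ?_,
    fun κ _ hκ hT M P hP A hA n x => ?_⟩
  · rintro ⟨a, b, hab⟩
    obtain ⟨θ, hθ, h⟩ := small φ
    exact hθ.not_orderLike hT (hcup hP) ⟨a, b, .inl fun k l => (h M P hP _).symm.trans (hab k l)⟩
  · rintro ⟨a, b, hab⟩
    obtain ⟨θ, hθ, h⟩ := small φ
    refine hθ.not_shattersFinite hT (hcup hP) fun N =>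
      ⟨fun k => a k, fun s => b {k | ∃ l ∈ s, (l : ℕ) = k}, fun k s => ?_⟩
    refine ((h M P hP _).symm.trans (hab _ _)).trans ?_
    exact ⟨fun ⟨l, hl, e⟩ => Fin.ext e ▸ hl, fun hk => ⟨k, hk, rfl⟩⟩
  · refine ManySorted.FusionFamily.mk_typeSpace_le (fun ψ => ?_) hκ
      fun i => hT i M _ (ManySorted.FusionFamily.models_red (hcup hP) i) A hA n x
    obtain ⟨θ, hθ, h⟩ := large ψ
    exact ⟨θ, hθ, fun a => h M P hP _⟩
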